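/- Let $\Bbbk$ be a field of characteristic $0$. For $i=1,2$ let $E_i$ be a $\Sigma_2$-module, regarded as a space of binary operations, let $R_i\subseteq\mathcal F(E_i)(3)$ be a $\Sigma_3$-submodule of the arity-three component of the free operad on $E_i$, and let $\mathcal P_i=\mathcal F(E_i)/(R_i)$ be the corresponding quadratic operad. Put $E=E_1\oplus E_2$ and let $\mathcal F(E)(3)_{ij}\subseteq\mathcal F(E)(3)$ be the $\Sigma_3$-submodule generated by the compositions $\mu(1,\nu)$ and $\mu(\nu,1)$ with $\mu\in E_i$ and $\nu\in E_j$. For a linear map $$\mathcal D\colon \mathcal F(E)(3)_{12}\longrightarrow \mathcal F(E)(3)_{21}$$ put $R_{\mathcal D}=\{x-\mathcal D(x) : x\in\mathcal F(E)(3)_{12}\}$ and $\mathcal P=\mathcal F(E)/(R_1\oplus R_{\mathcal D}\oplus R_2)$. The map $\mathcal D$ is called a distributive law of $\mathcal P_1$ over $\mathcal P_2$ if it is $\Sigma_3$-equivariant and if, for every $n\ge 2$, the map $$\xi(n)\colon (\mathcal P_2\circ\mathcal P_1)(n)\longrightarrow\mathcal P(n),\qquad \mu\otimes(\nu_1\otimes\dots\otimes\nu_l)\longmapsto\mu(\nu_1,\dots,\nu_l),$$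 is an isomorphism; here $(\mathcal P_2\circ\mathcal P_1)(n)=\bigoplus_{\pi}\mathcal P_2[\pi]\otimes\bigotimes_{B\in\pi}\mathcal P_1[B]$, where the sum is over the partitions $\pi$ of $\{1,\dots,n\}$ into nonempty blocks $B$ and $\mathcal P_i[S]$ is the space of operations of $\mathcal P_i$ with inputs labelled by the finite set $S$. The law $\mathcal D=0$ is called trivial. Let $\mathcal Com$ be the quadratic operad generated by one commutative associative binary operation, and $\mathcal Lie$ the one generated by one antisymmetric binary operation that satisfies the Jacobi identity. **Theorem.** The only distributive law of $\mathcal Com$ over $\mathcal Com$ is the trivial one; that is, for $\mathcal P_1=\mathcal P_2=\mathcal Com$ a linear map $\mathcal D\colon\mathcal F(E)(3)_{12}\to\mathcal F(E)(3)_{21}$ is a distributive law if and only if $\mathcal D=0$. Dually, the only distributive law of $\mathcal Lie$ over $\mathcal Lie$ is the trivial one. -/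

import Mathlib

open scoped TensorProduct DirectSum

namespace DistLaw

universe u

/-- Planar binary trees whose vertices carry operation symbols from `C` and whose leaves are
labelled by `X`: the monomials in the binary operations `c ∈ C`. -/
inductive BTree (C X : Type) : Type
  | leaf (x : X) : BTree C X
  | node (c : C) (l r : BTree C X) : BTree C X

namespace BTree

variable {C C' X Y : Type}

/-- The multiset of leaf labels. -/
def leaves : BTree C X → Multiset X
  | leaf x => {x}
  | node _ l r => l.leaves + r.leaves

/-- Renaming the operation symbols. -/
def recolor (f : C → C') : BTree C X → BTree C' X
  | leaf x => leaf x
  | node c l r => node (f c) (l.recolor f) (r.recolor f)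

/-- Renaming the leaves. -/
def relabel (f : X → Y) : BTree C X → BTree C Y
  | leaf x => leaf (f x)
  | node c l r => node c (l.relabel f) (r.relabel f)

theorem leaves_recolor (f : C → C') (t : BTree C X) : (t.recolor f).leaves = t.leaves := by
  induction t with
  | leaf x => rfl
  | node c l r hl hr => simp [recolor, leaves, hl, hr]

theorem leaves_relabel (f : X → Y) (t : BTree C X) :
    (t.relabel f).leaves = t.leaves.map f := by
  induction t with
  | leaf x => simp [relabel, leaves]
  | node c l r hl hr => simp [relabel, leaves, hl, hr]

end BTree

/-- Formal linear combinations of trees. -/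
abbrev TreeMod (k : Type u) [Field k] (C X : Type) : Type u := BTree C X →₀ k

section Trees

variable {k : Type u} [Field k] {C C' X Y Z : Type}

/-- The bilinear extension of `(l, r) ↦ node c l r`. -/
noncomputable def graft (c : C) : TreeMod k C X →ₗ[k] TreeMod k C X →ₗ[k] TreeMod k C X :=
  Finsupp.linearCombination k fun l =>
    Finsupp.linearCombination k fun r => Finsupp.single (BTree.node c l r) (1 : k)

/-- Substitution of `s y` for the leaves labelled `y` of a tree. -/
noncomputable def evalTree (s : Y → TreeMod k C X) : BTree C Y → TreeMod k C X
  | BTree.leaf y => s y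
  | BTree.node c l r => graft c (evalTree s l) (evalTree s r)

/-- Substitution, extended linearly to combinations of trees. -/
noncomputable def subst (s : Y → TreeMod k C X) : TreeMod k C Y →ₗ[k] TreeMod k C X :=
  Finsupp.linearCombination k (evalTree s)

/-- Renaming the operation symbols, extended linearly. -/
noncomputable def recolorLin (f : C → C') : TreeMod k C X →ₗ[k] TreeMod k C' X :=
  Finsupp.lmapDomain k k (BTree.recolor f)

/-- The span of the trees whose multiset of leaf labels is `m`. If `m` is a finite set `S`, this is
the space of multilinear monomials in the elements of `S`, i.e. the component indexed by `S` of the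
free operad on binary operations `c ∈ C` without symmetry. -/
noncomputable def Homog (k : Type u) [Field k] (C : Type) {X : Type} (m : Multiset X) :
    Submodule k (TreeMod k C X) :=
  Finsupp.supported k k {t | t.leaves = m}

@[simp] theorem graft_single (c : C) (l r : BTree C X) (a b : k) :
    graft c (Finsupp.single l a) (Finsupp.single r b)
      = Finsupp.single (BTree.node c l r) (a * b) := by
  simp [graft]

@[simp] theorem subst_single (s : Y → TreeMod k C X) (t : BTree C Y) (a : k) :
    subst s (Finsupp.single t a) = a • evalTree s t := by
  simp [subst]

theorem single_mem_Homog {t : BTree C X} {m : Multiset X} (h : t.leaves = m) (a : k) :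
    Finsupp.single t a ∈ Homog k C m :=
  Finsupp.single_mem_supported k a h

theorem Homog_induction {m : Multiset X} {p : TreeMod k C X → Prop}
    (single : ∀ t : BTree C X, t.leaves = m → p (Finsupp.single t 1)) (zero : p 0)
    (add : ∀ x y, p x → p y → p (x + y)) (smul : ∀ (a : k) x, p x → p (a • x))
    {x : TreeMod k C X} (hx : x ∈ Homog k C m) : p x := by
  rw [Homog, Finsupp.supported_eq_span_single] at hx
  induction hx using Submodule.span_induction with
  | mem x h => obtain ⟨t, ht, rfl⟩ := h; exact single t ht
  | zero => exact zero
  | add x y _ _ hx hy => exact add x y hx hy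
  | smul a x _ hx => exact smul a x hx

theorem graft_mem {c : C} {a b : Multiset X} {x y : TreeMod k C X} (hx : x ∈ Homog k C a)
    (hy : y ∈ Homog k C b) : graft c x y ∈ Homog k C (a + b) := by
  refine Homog_induction (p := fun x => graft c x y ∈ Homog k C (a + b)) ?_ (by simp)
    (fun x x' h h' => by simpa using add_mem h h')
    (fun r x h => by simpa using Submodule.smul_mem _ r h) hx
  intro t ht
  refine Homog_induction (p := fun y => graft c _ y ∈ Homog k C (a + b)) ?_ (by simp)
    (fun x x' h h' => by simpa using add_mem h h')
    (fun r x h => by simpa using Submodule.smul_mem _ r h) hy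
  intro t' ht'
  rw [graft_single]
  exact single_mem_Homog (by simp [BTree.leaves, ht, ht']) _

theorem evalTree_mem {s : Y → TreeMod k C X} {d : Y → Multiset X}
    (hs : ∀ y, s y ∈ Homog k C (d y)) (t : BTree C Y) :
    evalTree s t ∈ Homog k C (t.leaves.bind d) := by
  induction t with
  | leaf y => simpa [evalTree, BTree.leaves] using hs y
  | node c l r hl hr => simpa [evalTree, BTree.leaves] using graft_mem hl hr

theorem subst_mem {s : Y → TreeMod k C X} {d : Y → Multiset X}
    (hs : ∀ y, s y ∈ Homog k C (d y)) {m : Multiset Y} {x : TreeMod k C Y}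
    (hx : x ∈ Homog k C m) : subst s x ∈ Homog k C (m.bind d) := by
  refine Homog_induction (p := fun x => subst s x ∈ Homog k C (m.bind d)) ?_ (by simp)
    (fun x x' h h' => by simpa using add_mem h h')
    (fun r x h => by simpa using Submodule.smul_mem _ r h) hx
  rintro t rfl
  simpa using evalTree_mem hs t

theorem subst_graft (s : Y → TreeMod k C X) (c : C) (x y : TreeMod k C Y) :
    subst s (graft c x y) = graft c (subst s x) (subst s y) := by
  induction x using Finsupp.induction_linear with
  | zero => simp
  | add x x' h h' => simp [h, h']
  | single t a =>
    induction y using Finsupp.induction_linear with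
    | zero => simp
    | add x x' h h' => simp [h, h']
    | single t' b => simp [evalTree, mul_smul, smul_comm a b, -Finsupp.single_mul]

theorem subst_subst (s : Y → TreeMod k C X) (u : Z → TreeMod k C Y) (x : TreeMod k C Z) :
    subst s (subst u x) = subst (fun z => subst s (u z)) x := by
  induction x using Finsupp.induction_linear with
  | zero => simp
  | add x x' h h' => simp [h, h']
  | single t a =>
    simp only [subst_single, map_smul]
    congr 1
    induction t with
    | leaf z => rfl
    | node c l r hl hr => simp [evalTree, subst_graft, hl, hr]

@[simp] theorem recolorLin_single (f : C → C') (t : BTree C X) (a : k) :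
    recolorLin f (Finsupp.single t a) = Finsupp.single (t.recolor f) a := by
  simp [recolorLin]

theorem recolorLin_mem (f : C → C') {m : Multiset X} {x : TreeMod k C X}
    (hx : x ∈ Homog k C m) : recolorLin f x ∈ Homog k C' m := by
  refine Homog_induction (p := fun x => recolorLin f x ∈ Homog k C' m) ?_ (by simp)
    (fun x x' h h' => by simpa using add_mem h h')
    (fun r x h => by simpa using Submodule.smul_mem _ r h) hx
  intro t ht
  rw [recolorLin_single]
  exact single_mem_Homog (by rw [BTree.leaves_recolor, ht]) _

theorem recolorLin_graft (f : C → C') (c : C) (x y : TreeMod k C X) :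
    recolorLin f (graft c x y) = graft (f c) (recolorLin f x) (recolorLin f y) := by
  induction x using Finsupp.induction_linear with
  | zero => simp
  | add x x' h h' => simp [h, h']
  | single t a =>
    induction y using Finsupp.induction_linear with
    | zero => simp
    | add x x' h h' => simp [h, h']
    | single t' b => simp [BTree.recolor, -Finsupp.single_mul]

theorem recolorLin_subst (f : C → C') (s : Y → TreeMod k C X) (x : TreeMod k C Y) :
    recolorLin f (subst s x) = subst (fun y => recolorLin f (s y)) (recolorLin f x) := by
  induction x using Finsupp.induction_linear with
  | zero => simp
  | add x x' h h' => simp [h, h']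
  | single t a =>
    simp only [subst_single, map_smul, recolorLin_single]
    congr 1
    induction t with
    | leaf z => rfl
    | node c l r hl hr => simp [evalTree, BTree.recolor, recolorLin_graft, hl, hr]

theorem evalTree_congr {s s' : Y → TreeMod k C X} {t : BTree C Y}
    (h : ∀ y ∈ t.leaves, s y = s' y) : evalTree s t = evalTree s' t := by
  induction t with
  | leaf y => exact h y (by simp [BTree.leaves])
  | node c l r hl hr =>
    simp only [evalTree]
    rw [hl fun y hy => h y (by simp [BTree.leaves, hy]),
      hr fun y hy => h y (by simp [BTree.leaves, hy])]

/-- Substitution into a tree without repeated leaves is linear in each argument. -/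
theorem evalTree_lin {s s₁ s₂ : Y → TreeMod k C X} {t : BTree C Y} (ht : t.leaves.Nodup) {y : Y}
    (hy : y ∈ t.leaves) (a b : k) (h₁ : ∀ z, z ≠ y → s z = s₁ z) (h₂ : ∀ z, z ≠ y → s z = s₂ z)
    (h : s y = a • s₁ y + b • s₂ y) :
    evalTree s t = a • evalTree s₁ t + b • evalTree s₂ t := by
  induction t with
  | leaf z =>
    obtain rfl : y = z := by simpa [BTree.leaves] using hy
    simpa [evalTree] using h
  | node c l r hl hr =>
    simp only [BTree.leaves, Multiset.nodup_add, Multiset.mem_add] at ht hy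
    obtain ⟨hnl, hnr, hd⟩ := ht
    simp only [evalTree]
    by_cases hyl : y ∈ l.leaves
    · have hyr : ∀ z ∈ r.leaves, z ≠ y := by
        rintro z hz rfl
        exact Multiset.disjoint_left.mp hd hyl hz
      rw [hl hnl hyl, evalTree_congr (fun z hz => (h₁ z (hyr z hz)).symm),
        evalTree_congr (s := s₂) (t := r) (fun z hz => (h₂ z (hyr z hz)).symm)]
      simp
    · have hyr : y ∈ r.leaves := hy.resolve_left hyl
      have hyl' : ∀ z ∈ l.leaves, z ≠ y := by
        rintro z hz rfl
        exact hyl hz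
      rw [hr hnr hyr, evalTree_congr (fun z hz => (h₁ z (hyl' z hz)).symm),
        evalTree_congr (s := s₂) (t := l) (fun z hz => (h₂ z (hyl' z hz)).symm)]
      simp

theorem subst_lin {s s₁ s₂ : Y → TreeMod k C X} {m : Multiset Y} (hm : m.Nodup) {y : Y}
    (hy : y ∈ m) (a b : k) (h₁ : ∀ z, z ≠ y → s z = s₁ z) (h₂ : ∀ z, z ≠ y → s z = s₂ z)
    (h : s y = a • s₁ y + b • s₂ y) {x : TreeMod k C Y} (hx : x ∈ Homog k C m) :
    subst s x = a • subst s₁ x + b • subst s₂ x := by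
  refine Homog_induction (p := fun x => subst s x = a • subst s₁ x + b • subst s₂ x) ?_
    (by simp) (fun x x' h h' => by simp only [map_add, h, h', smul_add]; abel)
    (fun r x h => by simp only [map_smul, h, smul_add, smul_comm r]) hx
  rintro t rfl
  simpa using evalTree_lin hm hy a b h₁ h₂ h

/-! ### Operads given by generators and relations -/

/-- Let `E` be the `Σ₂`-module with basis `C` on which the transposition acts by `c ↦ ε(c) c`, and
let `R` be a set of multilinear relations in three variables. `IdealMem ε R S x` says that `x` lies
in the component at the finite set `S` of the operadic ideal generated by the symmetries
`c(x, y) = ε(c) c(y, x)` and by `R` in the free operad on the binary operations `c ∈ C` without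
symmetry. This ideal is the smallest family of subspaces which contains the elements obtained by
substituting arbitrary elements with disjoint sets of leaves for the variables of a symmetry or of a
relation in `R`, and which is closed under grafting arbitrary elements with disjoint sets of leaves.

The index is a multiset only for convenience: the index of a composite is the sum of those of its
parts, so if it is a set, then it is the disjoint union of theirs. -/
inductive IdealMem (ε : C → ℤˣ) (R : Set (TreeMod k C (Fin 3))) :
    Multiset X → TreeMod k C X → Prop
  | symm (c : C) {a b : Multiset X} (x : Homog k C a) (y : Homog k C b) :
      IdealMem ε R (a + b) (graft c x.1 y.1 - ((ε c : ℤ) : k) • graft c y.1 x.1)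
  | rel {r : TreeMod k C (Fin 3)} (hr : r ∈ R) (d : Fin 3 → Multiset X)
      (s : ∀ i, Homog k C (d i)) :
      IdealMem ε R (d 0 + d 1 + d 2) (subst (fun i => (s i).1) r)
  | graft_left (c : C) {a b : Multiset X} {x : TreeMod k C X} (hx : IdealMem ε R a x)
      (y : Homog k C b) : IdealMem ε R (a + b) (graft c x y.1)
  | graft_right (c : C) {a b : Multiset X} {y : TreeMod k C X} (x : Homog k C a)
      (hy : IdealMem ε R b y) : IdealMem ε R (a + b) (graft c x.1 y)
  | zero (a : Multiset X) : IdealMem ε R a 0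
  | add {a : Multiset X} {x y : TreeMod k C X} (hx : IdealMem ε R a x) (hy : IdealMem ε R a y) :
      IdealMem ε R a (x + y)
  | smul {a : Multiset X} (r : k) {x : TreeMod k C X} (hx : IdealMem ε R a x) :
      IdealMem ε R a (r • x)

/-- The component at the finite set `S` of the free operad on the binary operations `c ∈ C`
without symmetry. -/
def Comp (k : Type u) [Field k] (C : Type) {X : Type} (S : Finset X) : Type u :=
  Homog k C S.val

noncomputable instance (S : Finset X) : AddCommGroup (Comp k C S) :=
  inferInstanceAs (AddCommGroup (Homog k C S.val))

noncomputable instance (S : Finset X) : Module k (Comp k C S) :=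
  inferInstanceAs (Module k (Homog k C S.val))

/-- The inclusion of a component into the space of all combinations of trees. -/
noncomputable def Comp.val {S : Finset X} : Comp k C S →ₗ[k] TreeMod k C X where
  toFun x := Subtype.val x
  map_add' _ _ := rfl
  map_smul' _ _ := rfl

/-- The element of a component given by a combination of trees. -/
def Comp.mk {S : Finset X} (x : TreeMod k C X) (hx : x ∈ Homog k C S.val) : Comp k C S := ⟨x, hx⟩

@[simp] theorem Comp.val_mk {S : Finset X} (x : TreeMod k C X) (hx : x ∈ Homog k C S.val) :
    (Comp.mk x hx).val = x := rfl

theorem Comp.val_mem {S : Finset X} (x : Comp k C S) : x.val ∈ Homog k C S.val := x.2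

theorem Comp.ext {S : Finset X} {x y : Comp k C S} (h : x.val = y.val) : x = y := Subtype.ext h

/-- A linear map of tree spaces that preserves the components indexed by `S` and `T`. -/
noncomputable def Comp.restrict {S : Finset X} {T : Finset Y}
    (f : TreeMod k C X →ₗ[k] TreeMod k C' Y)
    (hf : ∀ x ∈ Homog k C S.val, f x ∈ Homog k C' T.val) : Comp k C S →ₗ[k] Comp k C' T where
  toFun x := Comp.mk (f x.val) (hf _ x.val_mem)
  map_add' x y := Comp.ext (by simp)
  map_smul' r x := Comp.ext (by simp)

/-- The component at `S` of the operadic ideal generated by the symmetries `ε` and by `R`. -/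
noncomputable def ideal (ε : C → ℤˣ) (R : Set (TreeMod k C (Fin 3))) (S : Finset X) :
    Submodule k (Comp k C S) where
  carrier := {x | IdealMem ε R S.val x.val}
  zero_mem' := by simpa using IdealMem.zero _
  add_mem' hx hy := by simpa using IdealMem.add hx hy
  smul_mem' r _ hx := by simpa using IdealMem.smul r hx

/-- The component at the finite set `S` of the operad with generators `C` of symmetry `ε` and
relations `R`. For `R = ∅` this is the free operad `F(E)` on the `Σ₂`-module `E` with basis `C` on
which the transposition acts by `c ↦ ε(c) c`. The component in arity `n` is the one at `Finset.univ : Finset (Fin n)`. -/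
def Op (ε : C → ℤˣ) (R : Set (TreeMod k C (Fin 3))) (S : Finset X) : Type u :=
  Comp k C S ⧸ ideal ε R S

noncomputable instance (ε : C → ℤˣ) (R : Set (TreeMod k C (Fin 3))) (S : Finset X) :
    AddCommGroup (Op ε R S) :=
  inferInstanceAs (AddCommGroup (Comp k C S ⧸ ideal ε R S))

noncomputable instance (ε : C → ℤˣ) (R : Set (TreeMod k C (Fin 3))) (S : Finset X) :
    Module k (Op ε R S) :=
  inferInstanceAs (Module k (Comp k C S ⧸ ideal ε R S))

/-- The quotient map onto the component of the operad. -/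
noncomputable def Op.mk (ε : C → ℤˣ) (R : Set (TreeMod k C (Fin 3))) (S : Finset X) :
    Comp k C S →ₗ[k] Op ε R S :=
  (ideal ε R S).mkQ

theorem Op.mk_surjective (ε : C → ℤˣ) (R : Set (TreeMod k C (Fin 3))) (S : Finset X) :
    Function.Surjective (Op.mk ε R S) :=
  (ideal ε R S).mkQ_surjective

theorem Op.mk_eq_zero {ε : C → ℤˣ} {R : Set (TreeMod k C (Fin 3))} {S : Finset X}
    {x : Comp k C S} : Op.mk ε R S x = 0 ↔ x ∈ ideal ε R S :=
  Submodule.Quotient.mk_eq_zero _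

/-- The linear map on a component of the operad induced by one that kills the ideal. -/
noncomputable def Op.lift {N : Type*} [AddCommGroup N] [Module k N] {ε : C → ℤˣ}
    {R : Set (TreeMod k C (Fin 3))} {S : Finset X} (f : Comp k C S →ₗ[k] N)
    (hf : ∀ x ∈ ideal ε R S, f x = 0) : Op ε R S →ₗ[k] N :=
  (ideal ε R S).liftQ f hf

@[simp] theorem Op.lift_mk {N : Type*} [AddCommGroup N] [Module k N] {ε : C → ℤˣ}
    {R : Set (TreeMod k C (Fin 3))} {S : Finset X} (f : Comp k C S →ₗ[k] N)
    (hf : ∀ x ∈ ideal ε R S, f x = 0) (x : Comp k C S) : Op.lift f hf (Op.mk ε R S x) = f x :=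
  rfl

/-- The class of a tree. -/
noncomputable def ofTree (ε : C → ℤˣ) (R : Set (TreeMod k C (Fin 3))) (S : Finset X)
    (t : BTree C X) (h : t.leaves = S.val) : Op ε R S :=
  Op.mk ε R S (Comp.mk (Finsupp.single t 1) (single_mem_Homog h 1))

theorem evalTree_idealMem {ε : C → ℤˣ} {R : Set (TreeMod k C (Fin 3))} {s : Y → TreeMod k C X}
    {d : Y → Multiset X} (hs : ∀ y, s y ∈ Homog k C (d y)) {t : BTree C Y} {y : Y}
    (hy : y ∈ t.leaves) (h : IdealMem ε R (d y) (s y)) :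
    IdealMem ε R (t.leaves.bind d) (evalTree s t) := by
  induction t with
  | leaf z =>
    obtain rfl : y = z := by simpa [BTree.leaves] using hy
    simpa [evalTree, BTree.leaves] using h
  | node c l r hl hr =>
    simp only [BTree.leaves, Multiset.mem_add] at hy
    simp only [evalTree, BTree.leaves, Multiset.add_bind]
    rcases hy with hy | hy
    · exact IdealMem.graft_left c (hl hy) ⟨_, evalTree_mem hs r⟩
    · exact IdealMem.graft_right c ⟨_, evalTree_mem hs l⟩ (hr hy)

theorem subst_idealMem_right {ε : C → ℤˣ} {R : Set (TreeMod k C (Fin 3))}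
    {s : Y → TreeMod k C X} {d : Y → Multiset X} (hs : ∀ y, s y ∈ Homog k C (d y))
    {m : Multiset Y} {y : Y} (hy : y ∈ m) (h : IdealMem ε R (d y) (s y)) {x : TreeMod k C Y}
    (hx : x ∈ Homog k C m) : IdealMem ε R (m.bind d) (subst s x) := by
  refine Homog_induction (p := fun x => IdealMem ε R (m.bind d) (subst s x)) ?_
    (by simpa using IdealMem.zero _) (fun x x' h h' => by simpa using IdealMem.add h h')
    (fun r x h => by simpa using IdealMem.smul r h) hx
  rintro t rfl
  simpa using evalTree_idealMem hs hy h

theorem subst_idealMem_left {ε : C → ℤˣ} {R : Set (TreeMod k C (Fin 3))}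
    {s : Y → TreeMod k C X} {d : Y → Multiset X} (hs : ∀ y, s y ∈ Homog k C (d y))
    {m : Multiset Y} {x : TreeMod k C Y} (hx : IdealMem ε R m x) :
    IdealMem ε R (m.bind d) (subst s x) := by
  induction hx with
  | symm c x y =>
    simpa [subst_graft] using IdealMem.symm (ε := ε) (R := R) c ⟨_, subst_mem hs x.2⟩
      ⟨_, subst_mem hs y.2⟩
  | rel hr e u =>
    rw [subst_subst]
    simpa using IdealMem.rel (ε := ε) hr (fun i => (e i).bind d)
      (fun i => ⟨_, subst_mem hs (u i).2⟩)
  | graft_left c hx y ih =>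
    simpa [subst_graft] using IdealMem.graft_left c ih ⟨_, subst_mem hs y.2⟩
  | graft_right c x hy ih =>
    simpa [subst_graft] using IdealMem.graft_right c ⟨_, subst_mem hs x.2⟩ ih
  | zero => simpa using IdealMem.zero _
  | add _ _ h h' => simpa using IdealMem.add h h'
  | smul r _ h => simpa using IdealMem.smul r h

theorem recolor_idealMem {f : C → C'} {ε : C → ℤˣ} {ε' : C' → ℤˣ} (hε : ∀ c, ε' (f c) = ε c)
    {R : Set (TreeMod k C (Fin 3))} {R' : Set (TreeMod k C' (Fin 3))}
    (hR : ∀ r ∈ R, recolorLin f r ∈ R') {m : Multiset X} {x : TreeMod k C X}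
    (hx : IdealMem ε R m x) : IdealMem ε' R' m (recolorLin f x) := by
  induction hx with
  | symm c x y =>
    simpa [recolorLin_graft, hε] using IdealMem.symm (ε := ε') (R := R') (f c)
      ⟨_, recolorLin_mem f x.2⟩ ⟨_, recolorLin_mem f y.2⟩
  | rel hr e u =>
    rw [recolorLin_subst]
    exact IdealMem.rel (hR _ hr) e (fun i => ⟨_, recolorLin_mem f (u i).2⟩)
  | graft_left c hx y ih =>
    simpa [recolorLin_graft] using IdealMem.graft_left (f c) ih ⟨_, recolorLin_mem f y.2⟩
  | graft_right c x hy ih =>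
    simpa [recolorLin_graft] using IdealMem.graft_right (f c) ⟨_, recolorLin_mem f x.2⟩ ih
  | zero => simpa using IdealMem.zero _
  | add _ _ h h' => simpa using IdealMem.add h h'
  | smul r _ h => simpa using IdealMem.smul r h

/-- The operad morphism induced by a map of generators that carries relations to relations. -/
noncomputable def recolorOp (f : C → C') {ε : C → ℤˣ} {ε' : C' → ℤˣ} (hε : ∀ c, ε' (f c) = ε c)
    {R : Set (TreeMod k C (Fin 3))} {R' : Set (TreeMod k C' (Fin 3))}
    (hR : ∀ r ∈ R, recolorLin f r ∈ R') (S : Finset X) : Op ε R S →ₗ[k] Op ε' R' S :=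
  Op.lift (Op.mk ε' R' S ∘ₗ Comp.restrict (recolorLin f) fun _ hx => recolorLin_mem f hx)
    fun _ hx => Op.mk_eq_zero.mpr (recolor_idealMem hε hR hx)

theorem bind_perm {n : ℕ} (σ : Equiv.Perm (Fin n)) :
    ((Finset.univ : Finset (Fin n)).val.bind fun i => {σ i}) = Finset.univ.val := by
  rw [Multiset.bind_singleton]
  simp

theorem leaf_mem (σ : X → Y) (i : X) :
    (Finsupp.single (BTree.leaf (σ i)) 1 : TreeMod k C Y) ∈ Homog k C {σ i} :=
  single_mem_Homog rfl 1

/-- Renaming the leaf `i` to `σ i` in the component of arity `n`. -/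
noncomputable def actComp {n : ℕ} (σ : Equiv.Perm (Fin n)) :
    Comp k C (Finset.univ : Finset (Fin n)) →ₗ[k] Comp k C (Finset.univ : Finset (Fin n)) :=
  Comp.restrict (subst fun i => Finsupp.single (BTree.leaf (σ i)) 1)
    fun _ hx => by simpa only [bind_perm] using subst_mem (leaf_mem (k := k) (C := C) σ) hx

theorem actComp_mem (ε : C → ℤˣ) (R : Set (TreeMod k C (Fin 3))) {n : ℕ}
    (σ : Equiv.Perm (Fin n)) {x : Comp k C (Finset.univ : Finset (Fin n))}
    (hx : x ∈ ideal ε R Finset.univ) : actComp σ x ∈ ideal ε R Finset.univ := by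
  have := subst_idealMem_left (leaf_mem (k := k) (C := C) σ) (show IdealMem ε R _ x.val from hx)
  rw [bind_perm] at this
  exact this

/-- The action of `σ ∈ Σₙ` on the arity `n` component of an operad: the leaf `i` is renamed
to `σ i`. -/
noncomputable def act (ε : C → ℤˣ) (R : Set (TreeMod k C (Fin 3))) {n : ℕ}
    (σ : Equiv.Perm (Fin n)) :
    Op ε R (Finset.univ : Finset (Fin n)) →ₗ[k] Op ε R (Finset.univ : Finset (Fin n)) :=
  Op.lift (Op.mk ε R Finset.univ ∘ₗ actComp σ) fun _ hx => Op.mk_eq_zero.mpr (actComp_mem ε R σ hx)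

theorem act_ofTree (ε : C → ℤˣ) (R : Set (TreeMod k C (Fin 3))) {n : ℕ} (σ : Equiv.Perm (Fin n))
    (t : BTree C (Fin n)) (h : t.leaves = Finset.univ.val) :
    ∃ h', act ε R σ (ofTree ε R Finset.univ t h) = ofTree ε R Finset.univ (t.relabel σ) h' := by
  have h' : (t.relabel σ).leaves = (Finset.univ : Finset (Fin n)).val := by
    rw [BTree.leaves_relabel, h, ← Multiset.bind_singleton, bind_perm]
  refine ⟨h', ?_⟩
  unfold act ofTree
  rw [Op.lift_mk, LinearMap.comp_apply]
  congr 1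
  apply Comp.ext
  change subst _ (Finsupp.single t 1) = Finsupp.single (t.relabel σ) 1
  rw [subst_single, one_smul]
  clear h h'
  induction t with
  | leaf i => rfl
  | node c l r hl hr => simp [evalTree, BTree.relabel, hl, hr]

end Trees

/-! ### Operadic composition along a set partition -/

/-- A multilinear map that vanishes as soon as one argument lies in `p i` depends only on the classes
of its arguments modulo the `p i`. -/
theorem multilinear_congr {k : Type*} [Field k] {ι : Type*} [Fintype ι] {M : ι → Type*} {N : Type*}
    [∀ i, AddCommGroup (M i)] [∀ i, Module k (M i)] [AddCommGroup N] [Module k N]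
    (f : MultilinearMap k M N) (p : ∀ i, Submodule k (M i))
    (h : ∀ i s, s i ∈ p i → f s = 0) {s s' : ∀ i, M i} (hs : ∀ i, s i - s' i ∈ p i) :
    f s = f s' := by
  classical
  have key : ∀ T : Finset ι, f (T.piecewise s s') = f s' := by
    intro T
    induction T using Finset.induction_on with
    | empty => simp
    | insert i T hi ih =>
      rw [Finset.piecewise_insert, ← ih, ← sub_eq_zero]
      have e : T.piecewise s s' = Function.update (T.piecewise s s') i (s' i) := by
        conv_lhs => rw [← Function.update_eq_self i (T.piecewise s s')]
        simp [hi]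
      conv_lhs => rw [e]
      rw [Function.update_idem, ← MultilinearMap.map_update_sub]
      exact h i _ (by simpa using hs i)
  simpa using key Finset.univ

/-- Representatives of a family of classes. -/
noncomputable def quotRep {k : Type*} [Field k] {ι : Type*} {M : ι → Type*}
    [∀ i, AddCommGroup (M i)] [∀ i, Module k (M i)] {p : ∀ i, Submodule k (M i)}
    (q : ∀ i, M i ⧸ p i) (i : ι) : M i :=
  ((p i).mkQ_surjective (q i)).choose

theorem mkQ_quotRep {k : Type*} [Field k] {ι : Type*} {M : ι → Type*}
    [∀ i, AddCommGroup (M i)] [∀ i, Module k (M i)] {p : ∀ i, Submodule k (M i)}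
    (q : ∀ i, M i ⧸ p i) (i : ι) : (p i).mkQ (quotRep q i) = q i :=
  ((p i).mkQ_surjective (q i)).choose_spec

theorem descend_aux {k : Type*} [Field k] {ι : Type*} [Fintype ι] [DecidableEq ι] {M : ι → Type*}
    {N : Type*} [∀ i, AddCommGroup (M i)] [∀ i, Module k (M i)] [AddCommGroup N] [Module k N]
    (p : ∀ i, Submodule k (M i)) (f : MultilinearMap k M N)
    (h : ∀ i s, s i ∈ p i → f s = 0) (q : ∀ i, M i ⧸ p i) (i : ι) (c : M i) :
    f (quotRep (Function.update q i ((p i).mkQ c))) = f (Function.update (quotRep q) i c) := by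
  refine multilinear_congr f p h fun j => ?_
  rw [← Submodule.ker_mkQ (p j), LinearMap.mem_ker, map_sub, mkQ_quotRep, sub_eq_zero]
  rcases eq_or_ne j i with rfl | hj
  · simp
  · simp only [Function.update_of_ne hj, mkQ_quotRep]

/-- The multilinear map on quotients induced by `f`. -/
noncomputable def multilinearDescend {k : Type*} [Field k] {ι : Type*} [Fintype ι] {M : ι → Type*}
    {N : Type*} [∀ i, AddCommGroup (M i)] [∀ i, Module k (M i)] [AddCommGroup N] [Module k N]
    (p : ∀ i, Submodule k (M i)) (f : MultilinearMap k M N)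
    (h : ∀ i s, s i ∈ p i → f s = 0) : MultilinearMap k (fun i => M i ⧸ p i) N where
  toFun q := f (quotRep q)
  map_update_add' q i a b := by
    obtain ⟨a, rfl⟩ := (p i).mkQ_surjective a
    obtain ⟨b, rfl⟩ := (p i).mkQ_surjective b
    rw [← map_add, descend_aux p f h, descend_aux p f h, descend_aux p f h, f.map_update_add]
  map_update_smul' q i r a := by
    obtain ⟨a, rfl⟩ := (p i).mkQ_surjective a
    rw [← map_smul, descend_aux p f h, descend_aux p f h, f.map_update_smul]

theorem multilinearDescend_mk {k : Type*} [Field k] {ι : Type*} [Fintype ι] {M : ι → Type*}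
    {N : Type*} [∀ i, AddCommGroup (M i)] [∀ i, Module k (M i)] [AddCommGroup N] [Module k N]
    (p : ∀ i, Submodule k (M i)) (f : MultilinearMap k M N)
    (h : ∀ i s, s i ∈ p i → f s = 0) (s : ∀ i, M i) :
    multilinearDescend p f h (fun i => (p i).mkQ (s i)) = f s := by
  refine multilinear_congr f p h fun j => ?_
  rw [← Submodule.ker_mkQ (p j), LinearMap.mem_ker, map_sub, mkQ_quotRep, sub_self]

section Composition

variable {k : Type u} [Field k] {C X : Type} [DecidableEq X] {S : Finset X}

/-- A family indexed by the blocks of a partition, extended by zero. -/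
noncomputable def blockFun (π : Finpartition S) (s : ∀ B : π.parts, Comp k C B.1)
    (B : Finset X) : TreeMod k C X :=
  if h : B ∈ π.parts then (s ⟨B, h⟩).val else 0

theorem blockFun_coe (π : Finpartition S) (s : ∀ B : π.parts, Comp k C B.1) (B : π.parts) :
    blockFun π s B.1 = (s B).val := by
  simp [blockFun]

theorem blockFun_mem (π : Finpartition S) (s : ∀ B : π.parts, Comp k C B.1) (B : Finset X) :
    blockFun π s B ∈ Homog k C B.val := by
  unfold blockFun
  split_ifs with h
  · exact (s ⟨B, h⟩).val_mem
  · exact zero_mem _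

theorem bind_parts (π : Finpartition S) : (π.parts.val.bind fun B => B.val) = S.val := by
  conv_rhs => rw [← π.biUnion_parts, ← Finset.disjiUnion_eq_biUnion _ _ π.disjoint,
    Finset.disjiUnion_val]
  rfl

/-- Operadic composition `(t, (s_B)_B) ↦ t(s_B)_B` along a set partition `π` of `S`, for
combinations of trees: the tree `s_B` is grafted onto the leaf of `t` labelled by the block `B`. -/
noncomputable def gammaComp (π : Finpartition S) (x : Comp k C π.parts) :
    MultilinearMap k (fun B : π.parts => Comp k C B.1) (Comp k C S) where
  toFun s := Comp.mk (subst (blockFun π s) x.val) (by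
    simpa only [bind_parts] using subst_mem (blockFun_mem π s) x.val_mem)
  map_update_add' s B a b := by
    apply Comp.ext
    simp only [Comp.val_mk, map_add]
    have h := subst_lin (k := k) (s := blockFun π (Function.update s B (a + b)))
      (s₁ := blockFun π (Function.update s B a)) (s₂ := blockFun π (Function.update s B b))
      π.parts.nodup B.2 1 1 ?_ ?_ ?_ x.val_mem
    · simpa using h
    · intro z hz
      unfold blockFun
      split_ifs with h
      · rw [Function.update_of_ne, Function.update_of_ne] <;> exact fun e => hz (by rw [← e])
      · rfl
    · intro z hz
      unfold blockFun
      split_ifs with h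
      · rw [Function.update_of_ne, Function.update_of_ne] <;> exact fun e => hz (by rw [← e])
      · rfl
    · simp [blockFun_coe]
  map_update_smul' s B r a := by
    apply Comp.ext
    simp only [Comp.val_mk, map_smul]
    have h := subst_lin (k := k) (s := blockFun π (Function.update s B (r • a)))
      (s₁ := blockFun π (Function.update s B a)) (s₂ := blockFun π (Function.update s B a))
      π.parts.nodup B.2 r 0 ?_ ?_ ?_ x.val_mem
    · simpa using h
    · intro z hz
      unfold blockFun
      split_ifs with h
      · rw [Function.update_of_ne, Function.update_of_ne] <;> exact fun e => hz (by rw [← e])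
      · rfl
    · intro z hz
      unfold blockFun
      split_ifs with h
      · rw [Function.update_of_ne, Function.update_of_ne] <;> exact fun e => hz (by rw [← e])
      · rfl
    · simp [blockFun_coe]

theorem gammaComp_mem_left (ε : C → ℤˣ) (R : Set (TreeMod k C (Fin 3))) (π : Finpartition S)
    {x : Comp k C π.parts} (hx : x ∈ ideal ε R π.parts) (s : ∀ B : π.parts, Comp k C B.1) :
    gammaComp π x s ∈ ideal ε R S := by
  have := subst_idealMem_left (blockFun_mem π s) (show IdealMem ε R _ x.val from hx)
  rw [bind_parts] at this
  exact this

theorem gammaComp_mem_right (ε : C → ℤˣ) (R : Set (TreeMod k C (Fin 3))) (π : Finpartition S)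
    (x : Comp k C π.parts) (B : π.parts) (s : ∀ B : π.parts, Comp k C B.1)
    (hs : s B ∈ ideal ε R B.1) : gammaComp π x s ∈ ideal ε R S := by
  have := subst_idealMem_right (ε := ε) (R := R) (blockFun_mem π s) B.2
    (by rw [blockFun_coe]; exact hs) x.val_mem
  rw [bind_parts] at this
  exact this

theorem mk_gammaComp_eq_zero (ε : C → ℤˣ) (R : Set (TreeMod k C (Fin 3))) (π : Finpartition S)
    (x : Comp k C π.parts) (B : π.parts) (s : ∀ B : π.parts, Comp k C B.1)
    (hs : s B ∈ ideal ε R B.1) : (Op.mk ε R S).compMultilinearMap (gammaComp π x) s = 0 :=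
  Op.mk_eq_zero.mpr (gammaComp_mem_right ε R π x B s hs)

/-- Operadic composition `P[π] × ∏_{B ∈ π} P[B] → P[S]` along a set partition `π` of `S`, as a
function of the second argument. -/
noncomputable def gammaAux (ε : C → ℤˣ) (R : Set (TreeMod k C (Fin 3))) (π : Finpartition S)
    (x : Comp k C π.parts) :
    MultilinearMap k (fun B : π.parts => Op ε R B.1) (Op ε R S) :=
  multilinearDescend (fun B : π.parts => ideal ε R B.1)
    ((Op.mk ε R S).compMultilinearMap (gammaComp π x)) (mk_gammaComp_eq_zero ε R π x)

theorem gammaAux_apply (ε : C → ℤˣ) (R : Set (TreeMod k C (Fin 3))) (π : Finpartition S)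
    (x : Comp k C π.parts) (q : ∀ B : π.parts, Op ε R B.1) :
    gammaAux ε R π x q
      = Op.mk ε R S (gammaComp π x (quotRep (p := fun B : π.parts => ideal ε R B.1) q)) := rfl

/-- Operadic composition `P[π] × ∏_{B ∈ π} P[B] → P[S]` along a set partition `π` of `S`. -/
noncomputable def gamma (ε : C → ℤˣ) (R : Set (TreeMod k C (Fin 3))) (π : Finpartition S) :
    Op ε R π.parts →ₗ[k] MultilinearMap k (fun B : π.parts => Op ε R B.1) (Op ε R S) :=
  Op.lift
    { toFun := gammaAux ε R π
      map_add' := fun x y => by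
        ext q
        rw [add_apply, gammaAux_apply, gammaAux_apply, gammaAux_apply, ← map_add]
        congr 1
        exact Comp.ext (by simp [gammaComp])
      map_smul' := fun r x => by
        ext q
        rw [RingHom.id_apply, smul_apply, gammaAux_apply, gammaAux_apply, ← map_smul]
        congr 1
        exact Comp.ext (by simp [gammaComp]) }
    fun _ hx => MultilinearMap.ext fun _ => Op.mk_eq_zero.mpr (gammaComp_mem_left ε R π hx _)

/-- On classes of combinations of trees, operadic composition is given by grafting. -/
theorem gamma_mk (ε : C → ℤˣ) (R : Set (TreeMod k C (Fin 3))) (π : Finpartition S)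
    (x : Comp k C π.parts) (s : ∀ B : π.parts, Comp k C B.1) :
    gamma ε R π (Op.mk ε R π.parts x) (fun B => Op.mk ε R B.1 (s B))
      = Op.mk ε R S (gammaComp π x s) :=
  multilinearDescend_mk (fun B : π.parts => ideal ε R B.1)
    ((Op.mk ε R S).compMultilinearMap (gammaComp π x)) (mk_gammaComp_eq_zero ε R π x) s

end Composition

/-! ### The composite product and the map `ξ` -/

section Xi

variable {k : Type u} [Field k] {C₁ C₂ C : Type}

/-- The composite product `(P₂ ∘ P₁)[S] = ⨁_π P₂[π] ⊗ ⨂_{B ∈ π} P₁[B]`, the sum being over all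
partitions `π` of the finite set `S` into nonempty blocks `B`. Its elements are the formal
`μ(ν₁, …, ν_l)` with `μ ∈ P₂`, `ν_s ∈ P₁`, and `l` is the number of blocks. -/
abbrev Composite (ε₁ : C₁ → ℤˣ) (R₁ : Set (TreeMod k C₁ (Fin 3))) (ε₂ : C₂ → ℤˣ)
    (R₂ : Set (TreeMod k C₂ (Fin 3))) {X : Type} [DecidableEq X] (S : Finset X) : Type u :=
  ⨁ π : Finpartition S, Op ε₂ R₂ π.parts ⊗[k] (⨂[k] B : π.parts, Op ε₁ R₁ B.1)

/-- The map `ξ : (P₂ ∘ P₁)[S] → P[S]` that is induced by operad morphisms `P₁ → P`, `P₂ → P` (given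
by maps of generators) and by the composition of `P`. -/
noncomputable def xi {ε₁ : C₁ → ℤˣ} {R₁ : Set (TreeMod k C₁ (Fin 3))} {ε₂ : C₂ → ℤˣ}
    {R₂ : Set (TreeMod k C₂ (Fin 3))} {ε : C → ℤˣ} {R : Set (TreeMod k C (Fin 3))}
    (f₁ : C₁ → C) (f₂ : C₂ → C) (hε₁ : ∀ c, ε (f₁ c) = ε₁ c) (hε₂ : ∀ c, ε (f₂ c) = ε₂ c)
    (hR₁ : ∀ r ∈ R₁, recolorLin f₁ r ∈ R) (hR₂ : ∀ r ∈ R₂, recolorLin f₂ r ∈ R)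
    {X : Type} [DecidableEq X] (S : Finset X) :
    Composite ε₁ R₁ ε₂ R₂ S →ₗ[k] Op ε R S := by
  classical
  exact DirectSum.toModule k _ _ fun π =>
    TensorProduct.lift
      ((PiTensorProduct.lift (R := k) (s := fun B : π.parts => Op ε₁ R₁ B.1)).toLinearMap ∘ₗ
        MultilinearMap.compLinearMapₗ (fun B : π.parts => recolorOp f₁ hε₁ hR₁ B.1) ∘ₗ
        gamma ε R π ∘ₗ recolorOp f₂ hε₂ hR₂ π.parts)

end Xi

/-! ### Quadratic operads and distributive laws -/

section Quadratic

variable {C C₁ C₂ : Type}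

/-- `F(E)(3)`, the arity three component of the free operad on the `Σ₂`-module `E` with basis `C`
on which the transposition acts by `c ↦ ε(c) c`. -/
abbrev Free3 (k : Type u) [Field k] (ε : C → ℤˣ) : Type u :=
  Op (k := k) ε ∅ (Finset.univ : Finset (Fin 3))

/-- The combinations of trees that represent elements of `R ⊆ F(E)(3)`. -/
def relSet {k : Type u} [Field k] {ε : C → ℤˣ} (R : Submodule k (Free3 k ε)) :
    Set (TreeMod k C (Fin 3)) :=
  {x | ∃ hx : x ∈ Homog k C (Finset.univ : Finset (Fin 3)).val,
    Op.mk ε ∅ Finset.univ (Comp.mk x hx) ∈ R}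

/-- The component at `S` of the quadratic operad `⟨E; R⟩ = F(E)/(R)`. (It is written as one quotient
of the free operad without symmetry, by the ideal that the symmetries and the representatives of the
elements of `R` generate, i.e. by the preimage of the ideal `(R)` of `F(E)`.) -/
abbrev QuadOp {k : Type u} [Field k] {ε : C → ℤˣ} (R : Submodule k (Free3 k ε)) {X : Type}
    (S : Finset X) : Type u :=
  Op ε (relSet R) S

/-- The map `F(E')(3) → F(E)(3)` induced by a map of generators. -/
noncomputable def recolor3 (k : Type u) [Field k] {C' : Type} (f : C' → C) {ε' : C' → ℤˣ}
    {ε : C → ℤˣ} (hε : ∀ c, ε (f c) = ε' c) : Free3 k ε' →ₗ[k] Free3 k ε :=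
  recolorOp f hε (fun _ h => h.elim) Finset.univ

theorem recolorLin_mem_relSet {k : Type u} [Field k] {C' : Type} (f : C' → C) {ε' : C' → ℤˣ}
    {ε : C → ℤˣ} (hε : ∀ c, ε (f c) = ε' c) {R' : Submodule k (Free3 k ε')}
    {R : Submodule k (Free3 k ε)} (h : R'.map (recolor3 k f hε) ≤ R) :
    ∀ r ∈ relSet R', recolorLin f r ∈ relSet R := by
  rintro r ⟨hr, hrR⟩
  exact ⟨recolorLin_mem f hr, h ⟨_, hrR, rfl⟩⟩

/-- The span in `F(E)(3)` of the compositions `μ(1, ν)` and `μ(ν, 1)`, with all labellings of the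
inputs, where `μ` and `ν` are generators with `p μ` and `q ν`. -/
noncomputable def mixed (k : Type u) [Field k] (ε : C → ℤˣ) (p q : C → Prop) : Submodule k (Free3 k ε) :=
  Submodule.span k {z | ∃ (t : BTree C (Fin 3)) (ht : t.leaves = Finset.univ.val),
    z = ofTree ε ∅ Finset.univ t ht ∧
    ∃ (μ ν : C) (a b c : Fin 3), p μ ∧ q ν ∧
      (t = .node μ (.leaf a) (.node ν (.leaf b) (.leaf c)) ∨
        t = .node μ (.node ν (.leaf a) (.leaf b)) (.leaf c))}

/-- `mixed` is invariant under `Σ₃`. -/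
theorem act_mem_mixed {k : Type u} [Field k] {ε : C → ℤˣ} {p q : C → Prop}
    (σ : Equiv.Perm (Fin 3)) {x : Free3 k ε} (hx : x ∈ mixed k ε p q) :
    act ε ∅ σ x ∈ mixed k ε p q := by
  induction hx using Submodule.span_induction with
  | zero => simp
  | add x y _ _ hx hy => simpa using add_mem hx hy
  | smul r x _ hx => simpa using Submodule.smul_mem _ r hx
  | mem x h =>
    obtain ⟨t, ht, rfl, μ, ν, a, b, c, hμ, hν, h⟩ := h
    obtain ⟨h', e⟩ := act_ofTree (k := k) ε ∅ σ t ht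
    rw [e]
    refine Submodule.subset_span ⟨_, h', rfl, μ, ν, σ a, σ b, σ c, hμ, hν, ?_⟩
    rcases h with rfl | rfl
    · exact Or.inl rfl
    · exact Or.inr rfl

/-- `F(E₁ ⊕ E₂)(3)₁₂`: the outer operation is in `E₁` and the inner one in `E₂`. -/
noncomputable abbrev F12 (k : Type u) [Field k] (ε₁ : C₁ → ℤˣ) (ε₂ : C₂ → ℤˣ) :
    Submodule k (Free3 k (Sum.elim ε₁ ε₂)) :=
  mixed k (Sum.elim ε₁ ε₂) (fun c => c.isLeft) (fun c => c.isRight)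

/-- `F(E₁ ⊕ E₂)(3)₂₁`: the outer operation is in `E₂` and the inner one in `E₁`. -/
noncomputable abbrev F21 (k : Type u) [Field k] (ε₁ : C₁ → ℤˣ) (ε₂ : C₂ → ℤˣ) :
    Submodule k (Free3 k (Sum.elim ε₁ ε₂)) :=
  mixed k (Sum.elim ε₁ ε₂) (fun c => c.isRight) (fun c => c.isLeft)

variable {k : Type u} [Field k] {ε₁ : C₁ → ℤˣ} {ε₂ : C₂ → ℤˣ}

/-- The submodule `R₁ ⊕ R_D ⊕ R₂` of `F(E₁ ⊕ E₂)(3)`, where `R_D` consists of the `x - D x`. -/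
noncomputable def combinedRel (R₁ : Submodule k (Free3 k ε₁)) (R₂ : Submodule k (Free3 k ε₂))
    (D : F12 k ε₁ ε₂ →ₗ[k] F21 k ε₁ ε₂) : Submodule k (Free3 k (Sum.elim ε₁ ε₂)) :=
  R₁.map (recolor3 k (Sum.inl : C₁ → C₁ ⊕ C₂) fun _ => rfl) ⊔
    LinearMap.range ((F12 k ε₁ ε₂).subtype - (F21 k ε₁ ε₂).subtype ∘ₗ D) ⊔
    R₂.map (recolor3 k (Sum.inr : C₂ → C₁ ⊕ C₂) fun _ => rfl)

theorem inl_mem_combinedRel (R₁ : Submodule k (Free3 k ε₁)) (R₂ : Submodule k (Free3 k ε₂))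
    (D : F12 k ε₁ ε₂ →ₗ[k] F21 k ε₁ ε₂) :
    ∀ r ∈ relSet R₁, recolorLin (Sum.inl : C₁ → C₁ ⊕ C₂) r ∈ relSet (combinedRel R₁ R₂ D) :=
  recolorLin_mem_relSet (ε := Sum.elim ε₁ ε₂) (Sum.inl : C₁ → C₁ ⊕ C₂) (fun _ => rfl)
    (R' := R₁) (R := combinedRel R₁ R₂ D) (le_sup_left.trans le_sup_left)

theorem inr_mem_combinedRel (R₁ : Submodule k (Free3 k ε₁)) (R₂ : Submodule k (Free3 k ε₂))
    (D : F12 k ε₁ ε₂ →ₗ[k] F21 k ε₁ ε₂) :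
    ∀ r ∈ relSet R₂, recolorLin (Sum.inr : C₂ → C₁ ⊕ C₂) r ∈ relSet (combinedRel R₁ R₂ D) :=
  recolorLin_mem_relSet (ε := Sum.elim ε₁ ε₂) (Sum.inr : C₂ → C₁ ⊕ C₂) (fun _ => rfl)
    (R' := R₂) (R := combinedRel R₁ R₂ D) le_sup_right

/-- The map `ξ(n) : (P₂ ∘ P₁)(n) → P(n)`, where `P_i = ⟨E_i; R_i⟩` and
`P = ⟨E₁ ⊕ E₂; R₁ ⊕ R_D ⊕ R₂⟩`. -/
noncomputable def xiLaw (R₁ : Submodule k (Free3 k ε₁)) (R₂ : Submodule k (Free3 k ε₂))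
    (D : F12 k ε₁ ε₂ →ₗ[k] F21 k ε₁ ε₂) (n : ℕ) :
    Composite ε₁ (relSet R₁) ε₂ (relSet R₂) (Finset.univ : Finset (Fin n)) →ₗ[k]
      QuadOp (combinedRel R₁ R₂ D) (Finset.univ : Finset (Fin n)) :=
  xi (ε := Sum.elim ε₁ ε₂) (R := relSet (combinedRel R₁ R₂ D)) (Sum.inl : C₁ → C₁ ⊕ C₂)
    (Sum.inr : C₂ → C₁ ⊕ C₂) (fun _ => rfl) (fun _ => rfl) (inl_mem_combinedRel R₁ R₂ D)
    (inr_mem_combinedRel R₁ R₂ D) Finset.univ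

/-- `D : F(E₁ ⊕ E₂)(3)₁₂ → F(E₁ ⊕ E₂)(3)₂₁` is a distributive law of `P₁ = ⟨E₁; R₁⟩` over
`P₂ = ⟨E₂; R₂⟩`: it is `Σ₃`-equivariant and `ξ(n)` is an isomorphism for all `n ≥ 2`. -/
def IsDistributiveLaw (R₁ : Submodule k (Free3 k ε₁)) (R₂ : Submodule k (Free3 k ε₂))
    (D : F12 k ε₁ ε₂ →ₗ[k] F21 k ε₁ ε₂) : Prop :=
  (∀ (σ : Equiv.Perm (Fin 3)) (x : F12 k ε₁ ε₂),
    (D ⟨act _ ∅ σ x, act_mem_mixed σ x.2⟩ : Free3 k (Sum.elim ε₁ ε₂)) = act _ ∅ σ (D x)) ∧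
  ∀ n : ℕ, 2 ≤ n → Function.Bijective (xiLaw R₁ R₂ D n)

end Quadratic

/-! ### The operads `Com` and `Lie` -/

/-- The tree `(a b) c` in one binary operation. -/
abbrev leftComb (a b c : Fin 3) : BTree Unit (Fin 3) :=
  .node () (.node () (.leaf a) (.leaf b)) (.leaf c)

/-- The tree `a (b c)` in one binary operation. -/
abbrev rightComb (a b c : Fin 3) : BTree Unit (Fin 3) :=
  .node () (.leaf a) (.node () (.leaf b) (.leaf c))

theorem leaves_leftComb (σ : Equiv.Perm (Fin 3)) (i j l : Fin 3)
    (h : ({i} + {j} + {l} : Multiset (Fin 3)) = Finset.univ.val) :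
    (leftComb (σ i) (σ j) (σ l)).leaves = Finset.univ.val := by
  rw [← bind_perm σ, ← h]
  simp [BTree.leaves]

theorem leaves_rightComb (σ : Equiv.Perm (Fin 3)) (i j l : Fin 3)
    (h : ({i} + {j} + {l} : Multiset (Fin 3)) = Finset.univ.val) :
    (rightComb (σ i) (σ j) (σ l)).leaves = Finset.univ.val := by
  rw [← bind_perm σ, ← h]
  simp only [BTree.leaves, Multiset.add_bind, Multiset.singleton_bind, add_assoc]

/-- The generating operation of `Com` is symmetric. -/
abbrev comSign : Unit → ℤˣ := fun _ => 1

/-- The generating operation of `Lie` is antisymmetric. -/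
abbrev lieSign : Unit → ℤˣ := fun _ => -1

/-- The relations of `Com`: the `Σ₃`-module generated by associativity `(a b) c = a (b c)`. -/
noncomputable def comRel (k : Type u) [Field k] : Submodule k (Free3 k comSign) :=
  Submodule.span k (Set.range fun σ : Equiv.Perm (Fin 3) =>
    ofTree comSign ∅ Finset.univ (leftComb (σ 0) (σ 1) (σ 2)) (leaves_leftComb σ 0 1 2 rfl) -
    ofTree comSign ∅ Finset.univ (rightComb (σ 0) (σ 1) (σ 2)) (leaves_rightComb σ 0 1 2 rfl))

/-- The relations of `Lie`: the `Σ₃`-module generated by the Jacobi identity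
`[[a, b], c] + [[b, c], a] + [[c, a], b] = 0`. -/
noncomputable def lieRel (k : Type u) [Field k] : Submodule k (Free3 k lieSign) :=
  Submodule.span k (Set.range fun σ : Equiv.Perm (Fin 3) =>
    ofTree lieSign ∅ Finset.univ (leftComb (σ 0) (σ 1) (σ 2)) (leaves_leftComb σ 0 1 2 rfl) +
    ofTree lieSign ∅ Finset.univ (leftComb (σ 1) (σ 2) (σ 0))
      (leaves_leftComb σ 1 2 0 (by decide)) +
    ofTree lieSign ∅ Finset.univ (leftComb (σ 2) (σ 0) (σ 1))
      (leaves_leftComb σ 2 0 1 (by decide)))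

end DistLaw

/-! Write · for the operation of the first copy and * for that of the second (for Lie, [ , ] and { ,
}). Up to scalars, the Σ₃-translates of x·(y*z) span F(E)(3)₁₂, and x*(y·z), y*(z·x), z*(x·y) span
F(E)(3)₂₁. Invariance under the exchange of y and z, up to the common sign, puts an equivariant map
into the form x·(y*z) ↦ α x*(y·z) + β (y*(z·x) + z*(x·y)) (`exists_coeff`), and it is zero as soon
as α = β = 0 (`eq_zero_of_gen12`).

The constraint on α and β comes from arity four. Call a tree normal if no * occurs inside an
argument of a ·. For Com, the law rewrites both sides of (a·b)·(c*d) = a·(b·(c*d)) into normal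
trees; for Lie, it rewrites both terms of [{a,b},{c,d}] + [{c,d},{a,b}] = 0. Either way a
combination of normal trees vanishes in the operad of the law. Normal trees come under ξ from
elements of the composite product that do not depend on the law. Hence, if ξ(4) is injective for the
law, the same combination vanishes for the law 0 (`idealMem_trivial_of_injective`).

Algebras for the law 0 are easy to produce: given a P₁-algebra W, a P₂-algebra F and a linear map φ
: W → F, put (w,f)·(w',f') = (ww', φ(ww')) and (w,f)*(w',f') = (0, ff') on W × F (`satRel_mixOp`).
Evaluating the combination with W = F = k for Com, or W = F = k³ with the cross product for Lie, and
φ = id gives polynomial equations in α and β whose only solution is 0.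

Conversely the law 0 is distributive for any two operads. Each tree is normal or zero, so ξ is onto.
With free algebras for W and F and a φ that collapses the component of each block to a line, the
same construction yields functionals that recover the coordinates of an element of the composite
from its image, so ξ is injective (`xiLaw_zero_injective`). -/

namespace DistLaw

universe u v w

/-! ### Algebras with binary operations -/

section Algebras

variable {k : Type u} [Field k] {C C' X Y : Type}
variable {A : Type v} [AddCommGroup A] [Module k A]

/-- The value of a tree in a space with bilinear operations `op c`. -/
def treeVal (op : C → A →ₗ[k] A →ₗ[k] A) (s : X → A) : BTree C X → A
  | BTree.leaf x => s x
  | BTree.node c l r => op c (treeVal op s l) (treeVal op s r)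

/-- The value of a combination of trees in a space with bilinear operations. -/
noncomputable def evalAlg (op : C → A →ₗ[k] A →ₗ[k] A) (s : X → A) : TreeMod k C X →ₗ[k] A :=
  Finsupp.linearCombination k (treeVal op s)

@[simp] theorem evalAlg_single (op : C → A →ₗ[k] A →ₗ[k] A) (s : X → A) (t : BTree C X) (a : k) :
    evalAlg op s (Finsupp.single t a) = a • treeVal op s t := by
  simp [evalAlg]

@[simp] theorem evalAlg_graft (op : C → A →ₗ[k] A →ₗ[k] A) (s : X → A) (c : C)
    (x y : TreeMod k C X) :
    evalAlg op s (graft c x y) = op c (evalAlg op s x) (evalAlg op s y) := by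
  induction x using Finsupp.induction_linear with
  | zero => simp
  | add x x' h h' => simp [h, h']
  | single t a =>
    induction y using Finsupp.induction_linear with
    | zero => simp
    | add x x' h h' => simp [h, h']
    | single t' b => simp [treeVal, mul_smul, -Finsupp.single_mul, smul_comm a b]

theorem evalAlg_evalTree (op : C → A →ₗ[k] A →ₗ[k] A) (s : X → A) (u : Y → TreeMod k C X)
    (t : BTree C Y) :
    evalAlg op s (evalTree u t) = treeVal op (fun y => evalAlg op s (u y)) t := by
  induction t with
  | leaf y => rfl
  | node c l r hl hr => simp [evalTree, treeVal, hl, hr]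

theorem evalAlg_subst (op : C → A →ₗ[k] A →ₗ[k] A) (s : X → A) (u : Y → TreeMod k C X)
    (x : TreeMod k C Y) :
    evalAlg op s (subst u x) = evalAlg op (fun y => evalAlg op s (u y)) x := by
  induction x using Finsupp.induction_linear with
  | zero => simp
  | add x x' h h' => simp [h, h']
  | single t a => simp [evalAlg_evalTree]

theorem treeVal_recolor (op : C' → A →ₗ[k] A →ₗ[k] A) (s : X → A) (f : C → C') (t : BTree C X) :
    treeVal op s (t.recolor f) = treeVal (fun c => op (f c)) s t := by
  induction t with
  | leaf y => rfl
  | node c l r hl hr => simp [BTree.recolor, treeVal, hl, hr]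

theorem evalAlg_recolorLin (op : C' → A →ₗ[k] A →ₗ[k] A) (s : X → A) (f : C → C')
    (x : TreeMod k C X) :
    evalAlg op s (recolorLin f x) = evalAlg (fun c => op (f c)) s x := by
  induction x using Finsupp.induction_linear with
  | zero => simp
  | add x x' h h' => simp [h, h']
  | single t a => simp [treeVal_recolor]

/-- The operations `op` have the symmetries `ε`. -/
def IsSymm (ε : C → ℤˣ) (op : C → A →ₗ[k] A →ₗ[k] A) : Prop :=
  ∀ c x y, op c x y = ((ε c : ℤ) : k) • op c y x

/-- The operations `op` satisfy the relations `R`. -/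
def SatRel (R : Set (TreeMod k C (Fin 3))) (op : C → A →ₗ[k] A →ₗ[k] A) : Prop :=
  ∀ r ∈ R, ∀ s : Fin 3 → A, evalAlg op s r = 0

/-- Soundness: evaluation turns grafting into the operations and turns substitution into evaluation
at the values of the substituted elements, so every rule that generates the ideal preserves
vanishing. -/
theorem evalAlg_eq_zero {ε : C → ℤˣ} {R : Set (TreeMod k C (Fin 3))}
    {op : C → A →ₗ[k] A →ₗ[k] A} (hs : IsSymm ε op) (hR : SatRel R op) (s : X → A)
    {m : Multiset X} {x : TreeMod k C X} (hx : IdealMem ε R m x) : evalAlg op s x = 0 := by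
  induction hx with
  | symm c x y =>
    rw [map_sub, map_smul, evalAlg_graft, evalAlg_graft, hs c, sub_self]
  | rel hr d u => rw [evalAlg_subst]; exact hR _ hr _
  | graft_left c hx y ih => simp [ih]
  | graft_right c x hy ih => simp [ih]
  | zero => simp
  | add _ _ h h' => simp [h, h']
  | smul r _ h => simp [h]

/-- The value of an element of an operad component in an algebra over the operad. -/
noncomputable def evalOp {ε : C → ℤˣ} {R : Set (TreeMod k C (Fin 3))}
    {op : C → A →ₗ[k] A →ₗ[k] A} (hs : IsSymm ε op) (hR : SatRel R op) (S : Finset X)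
    (s : X → A) : Op ε R S →ₗ[k] A :=
  Op.lift (evalAlg op s ∘ₗ Comp.val) fun _ hx => evalAlg_eq_zero hs hR s hx

theorem evalOp_mk {ε : C → ℤˣ} {R : Set (TreeMod k C (Fin 3))}
    {op : C → A →ₗ[k] A →ₗ[k] A} (hs : IsSymm ε op) (hR : SatRel R op) (S : Finset X)
    (s : X → A) (x : Comp k C S) : evalOp hs hR S s (Op.mk ε R S x) = evalAlg op s x.val := rfl

theorem satRel_empty (op : C → A →ₗ[k] A →ₗ[k] A) : SatRel ∅ op := fun _ h => h.elim

theorem evalOp_ofTree {ε : C → ℤˣ} {R : Set (TreeMod k C (Fin 3))}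
    {op : C → A →ₗ[k] A →ₗ[k] A} (hs : IsSymm ε op) (hR : SatRel R op) (S : Finset X)
    (s : X → A) (t : BTree C X) (ht : t.leaves = S.val) :
    evalOp hs hR S s (ofTree ε R S t ht) = treeVal op s t := by
  rw [ofTree, evalOp_mk, Comp.val_mk, evalAlg_single, one_smul]

/-- An algebra satisfies a submodule of relations if its evaluation map kills this submodule. -/
theorem satRel_relSet {ε : C → ℤˣ} {op : C → A →ₗ[k] A →ₗ[k] A} (hs : IsSymm ε op)
    {R : Submodule k (Free3 k ε)}
    (h : ∀ s : Fin 3 → A, R ≤ LinearMap.ker (evalOp hs (satRel_empty op) Finset.univ s)) :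
    SatRel (relSet R) op := by
  rintro r ⟨hr, hrR⟩ s
  exact h s hrR

theorem evalOp_recolor3 {f : C' → C} {ε' : C' → ℤˣ} {ε : C → ℤˣ} (hε : ∀ c, ε (f c) = ε' c)
    {op : C → A →ₗ[k] A →ₗ[k] A} (hs : IsSymm ε op) (s : Fin 3 → A) (x : Comp k C' Finset.univ) :
    evalOp hs (satRel_empty op) Finset.univ s (recolor3 k f hε (Op.mk ε' ∅ Finset.univ x)) =
      evalAlg (fun c => op (f c)) s x.val :=
  evalAlg_recolorLin op s f x.val

end Algebras

/-! ### The free algebra -/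

section FreeAlgebra

variable {k : Type u} [Field k] {C X : Type}

/-- The relations that define the free algebra on `X`. -/
noncomputable def totalIdeal (ε : C → ℤˣ) (R : Set (TreeMod k C (Fin 3))) (X : Type) :
    Submodule k (TreeMod k C X) :=
  Submodule.span k {x | ∃ m, IdealMem ε R m x}

/-- The free algebra on the set `X` over the operad with generators `C` of symmetry `ε` and
relations `R`. -/
abbrev FreeAlg (ε : C → ℤˣ) (R : Set (TreeMod k C (Fin 3))) (X : Type) : Type u :=
  TreeMod k C X ⧸ totalIdeal ε R X

theorem IdealMem.mem_totalIdeal {ε : C → ℤˣ} {R : Set (TreeMod k C (Fin 3))} {m : Multiset X}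
    {x : TreeMod k C X} (h : IdealMem ε R m x) : x ∈ totalIdeal ε R X :=
  Submodule.subset_span ⟨m, h⟩

theorem graft_mem_totalIdeal_left {ε : C → ℤˣ} {R : Set (TreeMod k C (Fin 3))} (c : C)
    {x : TreeMod k C X} (hx : x ∈ totalIdeal ε R X) (y : TreeMod k C X) :
    graft c x y ∈ totalIdeal ε R X := by
  induction hx using Submodule.span_induction with
  | zero => simp
  | add x x' _ _ h h' => simpa using add_mem h h'
  | smul r x _ h => simpa using Submodule.smul_mem _ r h
  | mem x h =>
    obtain ⟨m, h⟩ := h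
    induction y using Finsupp.induction_linear with
    | zero => simp
    | add x x' h h' => simpa using add_mem h h'
    | single t a =>
      exact (IdealMem.graft_left c h ⟨_, single_mem_Homog (m := t.leaves) rfl a⟩).mem_totalIdeal

theorem graft_mem_totalIdeal_right {ε : C → ℤˣ} {R : Set (TreeMod k C (Fin 3))} (c : C)
    (x : TreeMod k C X) {y : TreeMod k C X} (hy : y ∈ totalIdeal ε R X) :
    graft c x y ∈ totalIdeal ε R X := by
  induction hy using Submodule.span_induction with
  | zero => simp
  | add x x' _ _ h h' => simpa using add_mem h h'
  | smul r x _ h => simpa using Submodule.smul_mem _ r h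
  | mem y h =>
    obtain ⟨m, h⟩ := h
    induction x using Finsupp.induction_linear with
    | zero => simp
    | add x x' h h' => simpa using add_mem h h'
    | single t a =>
      exact (IdealMem.graft_right c ⟨_, single_mem_Homog (m := t.leaves) rfl a⟩ h).mem_totalIdeal

/-- The operations of the free algebra. -/
noncomputable def freeOp (ε : C → ℤˣ) (R : Set (TreeMod k C (Fin 3))) (X : Type) (c : C) :
    FreeAlg ε R X →ₗ[k] FreeAlg ε R X →ₗ[k] FreeAlg ε R X :=
  (totalIdeal ε R X).liftQ
    (LinearMap.mk₂ k (fun x y => (totalIdeal ε R X).liftQ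
        ((totalIdeal ε R X).mkQ ∘ₗ graft c x)
        (fun z hz => by simpa using graft_mem_totalIdeal_right c x hz) y)
      (fun x x' y => by obtain ⟨y, rfl⟩ := Submodule.mkQ_surjective _ y; simp)
      (fun a x y => by obtain ⟨y, rfl⟩ := Submodule.mkQ_surjective _ y; simp)
      (fun x y y' => by simp) (fun a x y => by simp))
    (fun x hx => by
      refine LinearMap.ext fun y => ?_
      obtain ⟨y, rfl⟩ := Submodule.mkQ_surjective _ y
      exact (Submodule.Quotient.mk_eq_zero _).mpr (graft_mem_totalIdeal_left c hx y))

theorem freeOp_mk (ε : C → ℤˣ) (R : Set (TreeMod k C (Fin 3))) (c : C) (x y : TreeMod k C X) :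
    freeOp ε R X c ((totalIdeal ε R X).mkQ x) ((totalIdeal ε R X).mkQ y) =
      (totalIdeal ε R X).mkQ (graft c x y) := rfl

/-- The ideal contains the symmetry only for homogeneous arguments; bilinearity reduces the general
case to single trees. -/
theorem isSymm_freeOp (ε : C → ℤˣ) (R : Set (TreeMod k C (Fin 3))) (X : Type) :
    IsSymm ε (freeOp ε R X) := by
  intro c x y
  obtain ⟨x, rfl⟩ := Submodule.mkQ_surjective _ x
  obtain ⟨y, rfl⟩ := Submodule.mkQ_surjective _ y
  rw [freeOp_mk, freeOp_mk, ← map_smul, ← sub_eq_zero, ← map_sub]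
  refine (Submodule.Quotient.mk_eq_zero _).mpr ?_
  induction x using Finsupp.induction_linear with
  | zero => simp
  | add x x' h h' =>
    convert add_mem h h' using 1
    simp only [map_add, LinearMap.add_apply, smul_add]
    abel
  | single t a =>
    induction y using Finsupp.induction_linear with
    | zero => simp
    | add x x' h h' =>
      convert add_mem h h' using 1
      simp only [map_add, LinearMap.add_apply, smul_add]
      abel
    | single t' b =>
      exact (IdealMem.symm c ⟨_, single_mem_Homog (m := t.leaves) rfl a⟩
        ⟨_, single_mem_Homog (m := t'.leaves) rfl b⟩).mem_totalIdeal

/-- `IdealMem.rel` only allows homogeneous substitutions. Since `r` is multilinear, an arbitrary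
argument can be expanded into trees one slot at a time; `T` is the set of slots that need not be
homogeneous yet. -/
theorem subst_mem_totalIdeal {ε : C → ℤˣ} {R : Set (TreeMod k C (Fin 3))} {r : TreeMod k C (Fin 3)}
    (hr : r ∈ R) (hr' : r ∈ Homog k C (Finset.univ : Finset (Fin 3)).val)
    (u : Fin 3 → TreeMod k C X) : subst u r ∈ totalIdeal ε R X := by
  suffices h : ∀ (T : Finset (Fin 3)) (u : Fin 3 → TreeMod k C X),
      (∀ i ∉ T, ∃ m, u i ∈ Homog k C m) → subst u r ∈ totalIdeal ε R X from
    h Finset.univ u (by simp)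
  intro T
  induction T using Finset.induction_on with
  | empty =>
    intro u hu
    choose d hd using fun i => hu i (Finset.notMem_empty i)
    exact (IdealMem.rel hr d fun i => ⟨u i, hd i⟩).mem_totalIdeal
  | insert i T hi ih =>
    intro u hu
    suffices h : ∀ x, subst (Function.update u i x) r ∈ totalIdeal ε R X by
      simpa using h (u i)
    intro x
    have hlin : ∀ (a b : k) (y z : TreeMod k C X), subst (Function.update u i (a • y + b • z)) r =
        a • subst (Function.update u i y) r + b • subst (Function.update u i z) r := fun a b y z =>
      subst_lin (Finset.univ : Finset (Fin 3)).nodup (Finset.mem_univ i) a b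
        (fun j hj => by simp [hj]) (fun j hj => by simp [hj]) (by simp) hr'
    induction x using Finsupp.induction_linear with
    | zero =>
      have := hlin 0 0 0 0
      simp only [zero_smul, add_zero] at this
      rw [this]
      exact zero_mem _
    | add y z hy hz =>
      have := hlin 1 1 y z
      simp only [one_smul] at this
      exact this ▸ add_mem hy hz
    | single t a =>
      refine ih _ fun j hj => ?_
      by_cases hji : j = i
      · subst hji
        exact ⟨t.leaves, by simpa using single_mem_Homog rfl a⟩
      · simpa [hji] using hu j (by simp [hji, hj])

theorem evalAlg_freeOp (ε : C → ℤˣ) (R : Set (TreeMod k C (Fin 3))) {Y : Type}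
    (u : Y → TreeMod k C X) (x : TreeMod k C Y) :
    evalAlg (freeOp ε R X) (fun y => (totalIdeal ε R X).mkQ (u y)) x =
      (totalIdeal ε R X).mkQ (subst u x) := by
  induction x using Finsupp.induction_linear with
  | zero => simp
  | add x x' h h' => simp only [map_add, h, h']
  | single t a =>
    rw [evalAlg_single, subst_single, map_smul]
    congr 1
    induction t with
    | leaf y => rfl
    | node c l r hl hr => rw [treeVal, hl, hr, freeOp_mk, evalTree]

theorem satRel_freeOp (ε : C → ℤˣ) {R : Set (TreeMod k C (Fin 3))}
    (hR : ∀ r ∈ R, r ∈ Homog k C (Finset.univ : Finset (Fin 3)).val) (X : Type) :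
    SatRel R (freeOp ε R X) := by
  intro r hr s
  choose u hu using fun i => Submodule.mkQ_surjective (totalIdeal ε R X) (s i)
  obtain rfl : (fun i => (totalIdeal ε R X).mkQ (u i)) = s := funext hu
  rw [evalAlg_freeOp]
  exact (Submodule.Quotient.mk_eq_zero _).mpr (subst_mem_totalIdeal hr (hR r hr) u)

/-- The ideal is graded by the multiset of leaves, because the relations are multilinear. This is
what makes the projection of the free algebra onto its multilinear components well defined. -/
theorem IdealMem.mem_Homog {ε : C → ℤˣ} {R : Set (TreeMod k C (Fin 3))}
    (hR : ∀ r ∈ R, r ∈ Homog k C (Finset.univ : Finset (Fin 3)).val) {m : Multiset X}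
    {x : TreeMod k C X} (hx : IdealMem ε R m x) : x ∈ Homog k C m := by
  induction hx with
  | symm c x y =>
    refine sub_mem (graft_mem x.2 y.2) (Submodule.smul_mem _ _ ?_)
    rw [add_comm]
    exact graft_mem y.2 x.2
  | rel hr d u =>
    have h := subst_mem (fun i => (u i).2) (hR _ hr)
    have e : (Finset.univ : Finset (Fin 3)).val = {0} + {1} + {2} := rfl
    simpa only [e, Multiset.add_bind, Multiset.singleton_bind] using h
  | graft_left c hx y ih => exact graft_mem ih y.2
  | graft_right c x hy ih => exact graft_mem x.2 ih
  | zero => exact zero_mem _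
  | add _ _ h h' => exact add_mem h h'
  | smul r _ h => exact Submodule.smul_mem _ r h

open Classical in
/-- The projection onto the component at `S`. -/
noncomputable def compProj (k : Type u) [Field k] (C : Type) {X : Type} (S : Finset X) :
    TreeMod k C X →ₗ[k] Comp k C S where
  toFun x := Comp.mk (x.filter fun t => t.leaves = S.val) fun t ht => by
    simpa using (Finset.mem_filter.mp ht).2
  map_add' x y := Comp.ext Finsupp.filter_add
  map_smul' a x := Comp.ext Finsupp.filter_smul

theorem compProj_of_mem {S : Finset X} (x : Comp k C S) : compProj k C S x.val = x := by
  classical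
  refine Comp.ext ?_
  refine (Finsupp.filter_eq_self_iff _ _).mpr fun t ht => ?_
  exact x.val_mem (Finsupp.mem_support_iff.mpr ht)

theorem compProj_of_ne {S : Finset X} {m : Multiset X} (hm : m ≠ S.val) {x : TreeMod k C X}
    (hx : x ∈ Homog k C m) : compProj k C S x = 0 := by
  classical
  refine Comp.ext ?_
  refine (Finsupp.filter_eq_zero_iff _ _).mpr fun t ht => ?_
  by_contra h
  exact hm ((hx (Finsupp.mem_support_iff.mpr h)).symm.trans ht)

/-- The projection of the free algebra onto the multilinear component at `S`. -/
noncomputable def FreeAlg.toOp (ε : C → ℤˣ) {R : Set (TreeMod k C (Fin 3))}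
    (hR : ∀ r ∈ R, r ∈ Homog k C (Finset.univ : Finset (Fin 3)).val) (S : Finset X) :
    FreeAlg ε R X →ₗ[k] Op ε R S :=
  (totalIdeal ε R X).liftQ (Op.mk ε R S ∘ₗ compProj k C S) <| by
    refine Submodule.span_le.mpr ?_
    rintro x ⟨m, hx⟩
    -- A generator of the ideal in the multidegree `S` is fixed by the projection and dies in the
    -- operad; one in another multidegree is projected to zero.
    by_cases hm : m = S.val
    · subst hm
      refine Op.mk_eq_zero.mpr ?_
      have := compProj_of_mem (Comp.mk x (hx.mem_Homog hR))
      rw [Comp.val_mk] at this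
      rw [this]
      exact hx
    · change Op.mk ε R S _ = 0
      rw [compProj_of_ne hm (hx.mem_Homog hR), map_zero]

theorem FreeAlg.toOp_mk (ε : C → ℤˣ) {R : Set (TreeMod k C (Fin 3))}
    (hR : ∀ r ∈ R, r ∈ Homog k C (Finset.univ : Finset (Fin 3)).val) (S : Finset X)
    (x : Comp k C S) :
    FreeAlg.toOp ε hR S ((totalIdeal ε R X).mkQ x.val) = Op.mk ε R S x := by
  change Op.mk ε R S (compProj k C S x.val) = _
  rw [compProj_of_mem]

theorem FreeAlg.toOp_mk_of_ne (ε : C → ℤˣ) {R : Set (TreeMod k C (Fin 3))}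
    (hR : ∀ r ∈ R, r ∈ Homog k C (Finset.univ : Finset (Fin 3)).val) (S : Finset X)
    {m : Multiset X} (hm : m ≠ S.val) {x : TreeMod k C X} (hx : x ∈ Homog k C m) :
    FreeAlg.toOp ε hR S ((totalIdeal ε R X).mkQ x) = 0 := by
  change Op.mk ε R S (compProj k C S x) = _
  rw [compProj_of_ne hm hx, map_zero]

theorem mem_Homog_of_mem_relSet {ε : C → ℤˣ} {R : Submodule k (Free3 k ε)} :
    ∀ r ∈ relSet R, r ∈ Homog k C (Finset.univ : Finset (Fin 3)).val := fun _ h => h.1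

end FreeAlgebra

/-! ### Algebras for the trivial law -/

section MixedAlgebra

variable {k : Type u} [Field k] {C₁ C₂ X : Type}
variable {W : Type v} [AddCommGroup W] [Module k W] {F : Type w} [AddCommGroup F] [Module k F]

/-- The operations on `W × F` for which the first kind of operation is that of `W`, followed by the
graph of `φ`, and the second kind of operation is that of `F`. -/
noncomputable def mixOp (op₁ : C₁ → W →ₗ[k] W →ₗ[k] W) (op₂ : C₂ → F →ₗ[k] F →ₗ[k] F)
    (φ : W →ₗ[k] F) : C₁ ⊕ C₂ → (W × F) →ₗ[k] (W × F) →ₗ[k] (W × F) :=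
  Sum.elim
    (fun c => ((op₁ c).compl₁₂ (LinearMap.fst k W F) (LinearMap.fst k W F)).compr₂
      (LinearMap.prod LinearMap.id φ))
    (fun c => ((op₂ c).compl₁₂ (LinearMap.snd k W F) (LinearMap.snd k W F)).compr₂
      (LinearMap.inr k W F))

variable (op₁ : C₁ → W →ₗ[k] W →ₗ[k] W) (op₂ : C₂ → F →ₗ[k] F →ₗ[k] F) (φ : W →ₗ[k] F)

@[simp] theorem mixOp_inl (c : C₁) (x y : W × F) :
    mixOp op₁ op₂ φ (Sum.inl c) x y = (op₁ c x.1 y.1, φ (op₁ c x.1 y.1)) := rfl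

@[simp] theorem mixOp_inr (c : C₂) (x y : W × F) :
    mixOp op₁ op₂ φ (Sum.inr c) x y = (0, op₂ c x.2 y.2) := rfl

variable {op₁ op₂}

theorem isSymm_mixOp {ε₁ : C₁ → ℤˣ} {ε₂ : C₂ → ℤˣ} (h₁ : IsSymm ε₁ op₁) (h₂ : IsSymm ε₂ op₂) :
    IsSymm (Sum.elim ε₁ ε₂) (mixOp op₁ op₂ φ) := by
  rintro (c | c) x y
  · rw [mixOp_inl, mixOp_inl, h₁ c x.1 y.1]
    simp
  · rw [mixOp_inr, mixOp_inr, h₂ c x.2 y.2]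
    simp

theorem fst_evalAlg_mixOp_inl (s : X → W × F) (x : TreeMod k C₁ X) :
    (evalAlg (fun c => mixOp op₁ op₂ φ (Sum.inl c)) s x).1 = evalAlg op₁ (fun i => (s i).1) x := by
  induction x using Finsupp.induction_linear with
  | zero => simp
  | add x x' h h' => simp [h, h']
  | single t a =>
    rw [evalAlg_single, evalAlg_single, Prod.smul_fst]
    congr 1
    induction t with
    | leaf y => rfl
    | node c l r hl hr => rw [treeVal, mixOp_inl, hl, hr, treeVal]

theorem snd_evalAlg_mixOp_inr (s : X → W × F) (x : TreeMod k C₂ X) :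
    (evalAlg (fun c => mixOp op₁ op₂ φ (Sum.inr c)) s x).2 = evalAlg op₂ (fun i => (s i).2) x := by
  induction x using Finsupp.induction_linear with
  | zero => simp
  | add x x' h h' => simp [h, h']
  | single t a =>
    rw [evalAlg_single, evalAlg_single, Prod.smul_snd]
    congr 1
    induction t with
    | leaf y => rfl
    | node c l r hl hr => rw [treeVal, mixOp_inr, hl, hr, treeVal]

/-- Each product of the first kind lies on the graph of `φ`, whatever its factors are. Single leaves
are excluded because their values are arbitrary pairs. -/
theorem snd_evalAlg_mixOp_inl (s : X → W × F) {m : Multiset X} (hm : m.card ≠ 1)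
    {x : TreeMod k C₁ X} (hx : x ∈ Homog k C₁ m) :
    (evalAlg (fun c => mixOp op₁ op₂ φ (Sum.inl c)) s x).2 =
      φ (evalAlg op₁ (fun i => (s i).1) x) := by
  refine Homog_induction (p := fun x => (evalAlg (fun c => mixOp op₁ op₂ φ (Sum.inl c)) s x).2 =
      φ (evalAlg op₁ (fun i => (s i).1) x)) ?_ (by simp) (fun x y h h' => by simp [h, h'])
      (fun a x h => by simp [h]) hx
  rintro (y | ⟨c, l, r⟩) rfl
  · simp [BTree.leaves] at hm
  · have := fst_evalAlg_mixOp_inl φ (op₂ := op₂) (op₁ := op₁) s (Finsupp.single (.node c l r) 1)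
    rw [← this]
    simp [treeVal]

theorem fst_evalAlg_mixOp_inr (s : X → W × F) {m : Multiset X} (hm : m.card ≠ 1)
    {x : TreeMod k C₂ X} (hx : x ∈ Homog k C₂ m) :
    (evalAlg (fun c => mixOp op₁ op₂ φ (Sum.inr c)) s x).1 = 0 := by
  refine Homog_induction (p := fun x => (evalAlg (fun c => mixOp op₁ op₂ φ (Sum.inr c)) s x).1 =
      0) ?_ (by simp) (fun x y h h' => by simp [h, h'])
      (fun a x h => by simp [h]) hx
  rintro (y | ⟨c, l, r⟩) rfl
  · simp [BTree.leaves] at hm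
  · simp [treeVal]

/-- If the variables themselves lie on the graph, single leaves need not be excluded. This covers
the one-element blocks of a partition. -/
theorem evalAlg_mixOp_inl_of_graph (s : X → W × F) (hs : ∀ i, (s i).2 = φ (s i).1)
    (x : TreeMod k C₁ X) :
    (evalAlg (fun c => mixOp op₁ op₂ φ (Sum.inl c)) s x).2 =
      φ (evalAlg op₁ (fun i => (s i).1) x) := by
  induction x using Finsupp.induction_linear with
  | zero => simp
  | add x x' h h' => simp [h, h']
  | single t a =>
    obtain y | ⟨c, l, r⟩ := t
    · simp [treeVal, hs]
    · refine snd_evalAlg_mixOp_inl φ s ?_ (single_mem_Homog rfl a)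
      have hpos : ∀ t : BTree C₁ X, 0 < t.leaves.card := fun t => by
        induction t with
        | leaf y => simp [BTree.leaves]
        | node c l r hl hr => simp [BTree.leaves, hl]
      have h1 := hpos l
      have h2 := hpos r
      simp only [BTree.leaves, Multiset.card_add]
      omega

/-- `W × F` is an algebra for the operad that is defined by the trivial law. -/
theorem satRel_mixOp {ε₁ : C₁ → ℤˣ} {ε₂ : C₂ → ℤˣ} (h₁ : IsSymm ε₁ op₁) (h₂ : IsSymm ε₂ op₂)
    {R₁ : Submodule k (Free3 k ε₁)} {R₂ : Submodule k (Free3 k ε₂)}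
    (hR₁ : SatRel (relSet R₁) op₁) (hR₂ : SatRel (relSet R₂) op₂) :
    SatRel (relSet (combinedRel R₁ R₂ 0)) (mixOp op₁ op₂ φ) := by
  -- Relations have three leaves, so the formulas for values that are genuine products apply to
  -- them.
  have hcard : (Finset.univ : Finset (Fin 3)).val.card ≠ 1 := by decide
  refine satRel_relSet (isSymm_mixOp φ h₁ h₂) fun s => ?_
  rw [combinedRel, sup_le_iff, sup_le_iff]
  refine ⟨⟨?_, ?_⟩, ?_⟩
  · rintro _ ⟨x, hx, rfl⟩
    obtain ⟨x, rfl⟩ := Op.mk_surjective _ _ _ x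
    rw [LinearMap.mem_ker, evalOp_recolor3]
    have h0 : evalAlg op₁ (fun i => (s i).1) x.val = 0 := hR₁ _ ⟨x.val_mem, hx⟩ _
    refine Prod.ext ?_ ?_
    · rw [fst_evalAlg_mixOp_inl, h0]; rfl
    · rw [snd_evalAlg_mixOp_inl φ s hcard x.val_mem, h0, map_zero]; rfl
  · rintro _ ⟨⟨x, hx⟩, rfl⟩
    rw [LinearMap.comp_zero, sub_zero, Submodule.subtype_apply]
    induction hx using Submodule.span_induction with
    | zero => exact zero_mem _
    | add x y _ _ hx hy => exact add_mem hx hy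
    | smul r x _ hx => exact Submodule.smul_mem _ r hx
    | mem x h =>
      obtain ⟨t, ht, rfl, μ, ν, a, b, c, hμ, hν, h⟩ := h
      rw [LinearMap.mem_ker, evalOp_ofTree]
      obtain ⟨μ, rfl⟩ := Sum.isLeft_iff.mp hμ
      obtain ⟨ν, rfl⟩ := Sum.isRight_iff.mp hν
      -- An operation of the first kind reads only the `W`-components, and a product of the second
      -- kind has `W`-component 0, so the composite vanishes on either side.
      rcases h with rfl | rfl <;> simp [treeVal]
  · rintro _ ⟨x, hx, rfl⟩
    obtain ⟨x, rfl⟩ := Op.mk_surjective _ _ _ x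
    rw [LinearMap.mem_ker, evalOp_recolor3]
    refine Prod.ext ?_ ?_
    · rw [fst_evalAlg_mixOp_inr φ s hcard x.val_mem]; rfl
    · rw [snd_evalAlg_mixOp_inr]
      exact hR₂ _ ⟨x.val_mem, hx⟩ _

end MixedAlgebra

/-! ### Values of `ξ` -/

section XiValues

variable {k : Type u} [Field k] {C₁ C₂ C : Type}

/-- Renaming the operation symbols on a component. -/
noncomputable def Comp.recolor (f : C₁ → C) {X : Type} (S : Finset X) :
    Comp k C₁ S →ₗ[k] Comp k C S :=
  Comp.restrict (recolorLin f) fun _ hx => recolorLin_mem f hx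

theorem Comp.val_recolor (f : C₁ → C) {X : Type} (S : Finset X) (x : Comp k C₁ S) :
    (Comp.recolor f S x).val = recolorLin f x.val := rfl

open Classical in
/-- A pure element of the composite product. -/
noncomputable def pureComposite {ε₁ : C₁ → ℤˣ} {R₁ : Set (TreeMod k C₁ (Fin 3))} {ε₂ : C₂ → ℤˣ}
    {R₂ : Set (TreeMod k C₂ (Fin 3))} {X : Type} [DecidableEq X] {S : Finset X}
    (π : Finpartition S) (x : Op ε₂ R₂ π.parts) (s : ∀ B : π.parts, Op ε₁ R₁ B.1) :
    Composite ε₁ R₁ ε₂ R₂ S :=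
  DirectSum.lof k (Finpartition S)
    (fun π => Op ε₂ R₂ π.parts ⊗[k] (⨂[k] B : π.parts, Op ε₁ R₁ B.1)) π
    (x ⊗ₜ PiTensorProduct.tprod k s)

theorem xi_pureComposite {ε₁ : C₁ → ℤˣ} {R₁ : Set (TreeMod k C₁ (Fin 3))} {ε₂ : C₂ → ℤˣ}
    {R₂ : Set (TreeMod k C₂ (Fin 3))} {ε : C → ℤˣ} {R : Set (TreeMod k C (Fin 3))}
    (f₁ : C₁ → C) (f₂ : C₂ → C) (hε₁ : ∀ c, ε (f₁ c) = ε₁ c) (hε₂ : ∀ c, ε (f₂ c) = ε₂ c)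
    (hR₁ : ∀ r ∈ R₁, recolorLin f₁ r ∈ R) (hR₂ : ∀ r ∈ R₂, recolorLin f₂ r ∈ R)
    {X : Type} [DecidableEq X] {S : Finset X} (π : Finpartition S)
    (x : Comp k C₂ π.parts) (s : ∀ B : π.parts, Comp k C₁ B.1) :
    xi (ε := ε) (R := R) f₁ f₂ hε₁ hε₂ hR₁ hR₂ S
      (pureComposite π (Op.mk ε₂ R₂ π.parts x) fun B => Op.mk ε₁ R₁ B.1 (s B)) =
    Op.mk ε R S (gammaComp π (Comp.recolor f₂ π.parts x) fun B => Comp.recolor f₁ B.1 (s B)) := by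
  classical
  rw [xi, pureComposite]
  erw [DirectSum.toModule_lof]
  rw [TensorProduct.lift.tmul]
  simp only [LinearMap.comp_apply, LinearEquiv.coe_coe, PiTensorProduct.lift.tprod]
  exact gamma_mk ε R π (Comp.recolor f₂ π.parts x) fun B => Comp.recolor f₁ B.1 (s B)

theorem xiLaw_pureComposite {ε₁ : C₁ → ℤˣ} {ε₂ : C₂ → ℤˣ} {R₁ : Submodule k (Free3 k ε₁)}
    {R₂ : Submodule k (Free3 k ε₂)} {D : F12 k ε₁ ε₂ →ₗ[k] F21 k ε₁ ε₂} {n : ℕ}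
    (π : Finpartition (Finset.univ : Finset (Fin n))) (x : Comp k C₂ π.parts)
    (s : ∀ B : π.parts, Comp k C₁ B.1) :
    xiLaw R₁ R₂ D n (pureComposite π (Op.mk ε₂ (relSet R₂) π.parts x)
      fun B => Op.mk ε₁ (relSet R₁) B.1 (s B)) =
    Op.mk _ _ _ (gammaComp π (Comp.recolor Sum.inr π.parts x)
      fun B => Comp.recolor Sum.inl B.1 (s B)) :=
  xi_pureComposite (ε := Sum.elim ε₁ ε₂) (ε₁ := ε₁) (ε₂ := ε₂) Sum.inl Sum.inr (fun _ => rfl)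
    (fun _ => rfl) (inl_mem_combinedRel R₁ R₂ D) (inr_mem_combinedRel R₁ R₂ D) π x s

end XiValues

/-! ### Normal trees -/

section NormalTrees

variable {k : Type u} [Field k] {C₁ C₂ X Y : Type}

/-- All operations of the tree are of the first kind. -/
def BTree.IsPure : BTree (C₁ ⊕ C₂) X → Prop
  | leaf _ => True
  | node c l r => c.isLeft ∧ l.IsPure ∧ r.IsPure

/-- No operation of the second kind is above one of the first kind. -/
def BTree.IsNormal : BTree (C₁ ⊕ C₂) X → Prop
  | leaf _ => True
  | node (Sum.inl _) l r => l.IsPure ∧ r.IsPure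
  | node (Sum.inr _) l r => l.IsNormal ∧ r.IsNormal

theorem BTree.IsPure.exists_recolor {t : BTree (C₁ ⊕ C₂) X} (h : t.IsPure) :
    ∃ t₁ : BTree C₁ X, t₁.recolor Sum.inl = t := by
  induction t with
  | leaf x => exact ⟨.leaf x, rfl⟩
  | node c l r hl hr =>
    obtain ⟨hc, h1, h2⟩ := h
    obtain ⟨c, rfl⟩ := Sum.isLeft_iff.mp hc
    obtain ⟨l, rfl⟩ := hl h1
    obtain ⟨r, rfl⟩ := hr h2
    exact ⟨.node c l r, rfl⟩

/-- Grafting of trees of the first kind onto the leaves of a tree of the second kind. -/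
def BTree.join (f : Y → BTree C₁ X) : BTree C₂ Y → BTree (C₁ ⊕ C₂) X
  | leaf y => (f y).recolor Sum.inl
  | node c l r => node (Sum.inr c) (join f l) (join f r)

theorem BTree.join_congr {f f' : Y → BTree C₁ X} {t : BTree C₂ Y}
    (h : ∀ y ∈ t.leaves, f y = f' y) : t.join f = t.join f' := by
  induction t with
  | leaf y => rw [join, join, h y (by simp [leaves])]
  | node c l r hl hr =>
    rw [join, join, hl fun y hy => h y (by simp [leaves, hy]),
      hr fun y hy => h y (by simp [leaves, hy])]

theorem BTree.leaves_ne_zero {C : Type} (t : BTree C X) : t.leaves ≠ 0 := by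
  induction t with
  | leaf x => simp [leaves]
  | node c l r hl hr => simp [leaves, hl]

theorem BTree.leaves_join {f : Finset X → BTree C₁ X} {t : BTree C₂ (Finset X)}
    (h : ∀ B ∈ t.leaves, (f B).leaves = B.val) :
    (t.join f).leaves = t.leaves.bind fun B => B.val := by
  induction t with
  | leaf y => simpa [join, leaves, leaves_recolor] using h
  | node c l r hl hr =>
    simp only [leaves, Multiset.mem_add] at h
    rw [join, leaves, hl fun B hB => h B (.inl hB), hr fun B hB => h B (.inr hB), leaves,
      Multiset.add_bind]

/-- A normal tree with distinct leaves is a composite along a set partition. -/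
theorem BTree.IsNormal.exists_join {t : BTree (C₁ ⊕ C₂) X} (h : t.IsNormal)
    (hn : t.leaves.Nodup) :
    ∃ (t₂ : BTree C₂ (Finset X)) (f : Finset X → BTree C₁ X),
      (∀ B ∈ t₂.leaves, (f B).leaves = B.val) ∧ t₂.leaves.Nodup ∧
      (∀ B ∈ t₂.leaves, ∀ B' ∈ t₂.leaves, B ≠ B' → Disjoint B B') ∧ t₂.join f = t := by
  classical
  -- A pure tree is a composite along the partition with one block, with a single leaf as its outer
  -- tree.
  have hp : ∀ t : BTree (C₁ ⊕ C₂) X, t.IsPure → t.leaves.Nodup →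
      ∃ (t₂ : BTree C₂ (Finset X)) (f : Finset X → BTree C₁ X),
        (∀ B ∈ t₂.leaves, (f B).leaves = B.val) ∧ t₂.leaves.Nodup ∧
        (∀ B ∈ t₂.leaves, ∀ B' ∈ t₂.leaves, B ≠ B' → Disjoint B B') ∧ t₂.join f = t := by
    intro t ht hn
    obtain ⟨t₁, rfl⟩ := ht.exists_recolor
    refine ⟨.leaf ⟨_, hn⟩, fun _ => t₁, ?_, by simp [leaves], ?_, rfl⟩
    · simp [leaves, leaves_recolor]
    · simp only [leaves, Multiset.mem_singleton]
      rintro _ rfl _ rfl h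
      exact absurd rfl h
  induction t with
  | leaf x => exact hp _ trivial hn
  | node c l r hl hr =>
    obtain c | c := c
    · exact hp _ ⟨rfl, h⟩ hn
    · simp only [leaves, Multiset.nodup_add] at hn
      obtain ⟨hnl, hnr, hd⟩ := hn
      obtain ⟨tl, fl, h1, h2, h3, rfl⟩ := hl h.1 hnl
      obtain ⟨tr, fr, g1, g2, g3, rfl⟩ := hr h.2 hnr
      rw [leaves_join h1, leaves_join g1] at hd
      have hdis : ∀ B ∈ tl.leaves, ∀ B' ∈ tr.leaves, Disjoint B B' := by
        intro B hB B' hB'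
        rw [Finset.disjoint_left]
        intro x hx hx'
        exact Multiset.disjoint_left.mp hd (Multiset.mem_bind.mpr ⟨B, hB, hx⟩)
          (Multiset.mem_bind.mpr ⟨B', hB', hx'⟩)
      -- A block on both sides would be disjoint from itself, hence empty, but it is the leaf set of
      -- a tree. Therefore `fl` and `fr` can be glued into one function on blocks.
      have hnot : ∀ B ∈ tr.leaves, B ∉ tl.leaves := by
        intro B hB hB'
        have := hdis B hB' B hB
        rw [disjoint_self, Finset.bot_eq_empty] at this
        subst this
        exact leaves_ne_zero _ (g1 _ hB)
      have el : tl.join (fun B => if B ∈ tl.leaves then fl B else fr B) = tl.join fl :=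
        join_congr fun B hB => if_pos hB
      have er : tr.join (fun B => if B ∈ tl.leaves then fl B else fr B) = tr.join fr :=
        join_congr fun B hB => if_neg (hnot B hB)
      refine ⟨.node c tl tr, fun B => if B ∈ tl.leaves then fl B else fr B, ?_, ?_, ?_, ?_⟩
      · intro B hB
        rcases Multiset.mem_add.mp hB with hB | hB
        · simp only [if_pos hB, h1 B hB]
        · simp only [if_neg (hnot B hB), g1 B hB]
      · exact Multiset.nodup_add.mpr
          ⟨h2, g2, Multiset.disjoint_left.mpr fun {B} hB hB' => hnot B hB' hB⟩
      · intro B hB B' hB' hne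
        rcases Multiset.mem_add.mp hB with hB | hB <;>
          rcases Multiset.mem_add.mp hB' with hB' | hB'
        · exact h3 B hB B' hB' hne
        · exact hdis B hB B' hB'
        · exact (hdis B' hB' B hB).symm
        · exact g3 B hB B' hB' hne
      · rw [join, el, er]

theorem evalTree_join {f : Y → BTree C₁ X} {u : Y → TreeMod k (C₁ ⊕ C₂) X} {t : BTree C₂ Y}
    (h : ∀ y ∈ t.leaves, u y = Finsupp.single ((f y).recolor Sum.inl) 1) :
    evalTree u (t.recolor Sum.inr) = Finsupp.single (t.join f) 1 := by
  induction t with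
  | leaf y => exact h y (by simp [BTree.leaves])
  | node c l r hl hr =>
    simp only [BTree.leaves, Multiset.mem_add] at h
    rw [BTree.recolor, evalTree, hl fun y hy => h y (.inl hy), hr fun y hy => h y (.inr hy),
      graft_single, one_mul, BTree.join]

variable {ε₁ : C₁ → ℤˣ} {ε₂ : C₂ → ℤˣ}

/-- The class of a normal tree is the image under `ξ` of an element that does not depend on the
law. -/
theorem exists_xiLaw_eq_ofTree (R₁ : Submodule k (Free3 k ε₁)) (R₂ : Submodule k (Free3 k ε₂))
    {n : ℕ} {t : BTree (C₁ ⊕ C₂) (Fin n)} (h : t.IsNormal)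
    (ht : t.leaves = (Finset.univ : Finset (Fin n)).val) :
    ∃ z, ∀ D, xiLaw R₁ R₂ D n z =
      ofTree (Sum.elim ε₁ ε₂) (relSet (combinedRel R₁ R₂ D)) Finset.univ t ht := by
  obtain ⟨t₂, f, hf, hn, hd, rfl⟩ := h.exists_join (ht ▸ Finset.univ.nodup)
  rw [BTree.leaves_join hf] at ht
  let π : Finpartition (Finset.univ : Finset (Fin n)) :=
    { parts := ⟨t₂.leaves, hn⟩
      supIndep := by
        rw [Finset.supIndep_iff_pairwiseDisjoint]
        intro B hB B' hB' hne
        exact hd B hB B' hB' hne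
      sup_parts := by
        refine Finset.eq_univ_iff_forall.mpr fun i => ?_
        have : i ∈ t₂.leaves.bind fun B => B.val := by rw [ht]; exact Finset.mem_univ i
        obtain ⟨B, hB, hi⟩ := Multiset.mem_bind.mp this
        exact Finset.mem_sup.mpr ⟨B, hB, hi⟩
      bot_notMem := fun h0 => BTree.leaves_ne_zero _ (hf _ h0) }
  refine ⟨pureComposite π
    (Op.mk _ _ _ (Comp.mk (Finsupp.single t₂ 1) (single_mem_Homog rfl 1)))
    (fun B => Op.mk _ _ _ (Comp.mk (Finsupp.single (f B.1) 1) (single_mem_Homog (hf _ B.2) 1))),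
    fun D => ?_⟩
  refine (xiLaw_pureComposite π _ _).trans ?_
  rw [ofTree]
  congr 1
  refine Comp.ext ?_
  change subst _ (recolorLin Sum.inr (Finsupp.single t₂ 1)) = Finsupp.single _ 1
  rw [recolorLin_single, subst_single, one_smul]
  refine evalTree_join fun B hB => ?_
  refine (blockFun_coe π _ ⟨B, hB⟩).trans ?_
  rw [Comp.val_recolor, Comp.val_mk, recolorLin_single]

/-- The combinations of normal trees that are multilinear in the variables `0, …, n - 1`. -/
noncomputable def normalSpan (k : Type u) [Field k] (C₁ C₂ : Type) (n : ℕ) :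
    Submodule k (TreeMod k (C₁ ⊕ C₂) (Fin n)) :=
  Submodule.span k {x | ∃ t : BTree (C₁ ⊕ C₂) (Fin n), t.IsNormal ∧
    t.leaves = (Finset.univ : Finset (Fin n)).val ∧ x = Finsupp.single t 1}

/-- The order of the quantifiers matters: one and the same preimage `z` serves all laws `D`, which
permits the comparison of two laws. -/
theorem exists_xiLaw_eq_mk (R₁ : Submodule k (Free3 k ε₁)) (R₂ : Submodule k (Free3 k ε₂))
    {n : ℕ} {x : TreeMod k (C₁ ⊕ C₂) (Fin n)} (hx : x ∈ normalSpan k C₁ C₂ n) :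
    ∃ (h : x ∈ Homog k (C₁ ⊕ C₂) (Finset.univ : Finset (Fin n)).val) (z : _),
      ∀ D, xiLaw R₁ R₂ D n z =
        Op.mk (Sum.elim ε₁ ε₂) (relSet (combinedRel R₁ R₂ D)) Finset.univ (Comp.mk x h) := by
  induction hx using Submodule.span_induction with
  | zero => exact ⟨zero_mem _, 0, fun D => by rw [map_zero]; exact (map_zero _).symm⟩
  | add x y _ _ hx hy =>
    obtain ⟨hx, z, hz⟩ := hx
    obtain ⟨hy, z', hz'⟩ := hy
    exact ⟨add_mem hx hy, z + z', fun D => by rw [map_add, hz, hz', ← map_add]; rfl⟩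
  | smul r x _ hx =>
    obtain ⟨hx, z, hz⟩ := hx
    exact ⟨Submodule.smul_mem _ r hx, r • z, fun D => by rw [map_smul, hz, ← map_smul]; rfl⟩
  | mem x h =>
    obtain ⟨t, hn, ht, rfl⟩ := h
    exact ⟨single_mem_Homog ht 1, exists_xiLaw_eq_ofTree R₁ R₂ hn ht⟩

/-- If `ξ` is injective for `D`, then a relation between normal trees that follows from `D` also
follows from the trivial law. -/
theorem idealMem_trivial_of_injective {R₁ : Submodule k (Free3 k ε₁)}
    {R₂ : Submodule k (Free3 k ε₂)} {D : F12 k ε₁ ε₂ →ₗ[k] F21 k ε₁ ε₂} {n : ℕ}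
    (hD : Function.Injective (xiLaw R₁ R₂ D n)) {x : TreeMod k (C₁ ⊕ C₂) (Fin n)}
    (hx : x ∈ normalSpan k C₁ C₂ n)
    (h : x ∈ totalIdeal (Sum.elim ε₁ ε₂) (relSet (combinedRel R₁ R₂ D)) (Fin n)) :
    IdealMem (Sum.elim ε₁ ε₂) (relSet (combinedRel R₁ R₂ 0))
      (Finset.univ : Finset (Fin n)).val x := by
  obtain ⟨hH, z, hz⟩ := exists_xiLaw_eq_mk R₁ R₂ hx
  have h0 : Op.mk (Sum.elim ε₁ ε₂) (relSet (combinedRel R₁ R₂ D)) Finset.univ (Comp.mk x hH) =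
      0 := by
    rw [← FreeAlg.toOp_mk _ mem_Homog_of_mem_relSet, Comp.val_mk,
      (Submodule.Quotient.mk_eq_zero _).mpr h |> fun e : Submodule.mkQ _ x = 0 => e, map_zero]
  -- The common preimage vanishes by injectivity for `D`; its image is then read off for the law 0.
  have hz0 : z = 0 := hD (by rw [hz D, h0, map_zero])
  have := hz 0
  rw [hz0, map_zero, eq_comm, Op.mk_eq_zero] at this
  exact this

/-! ### Surjectivity for the trivial law -/

/-- For D = 0 the relation x - D x is x itself. -/
theorem mem_relSet_of_mixed (R₁ : Submodule k (Free3 k ε₁)) (R₂ : Submodule k (Free3 k ε₂))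
    {t : BTree (C₁ ⊕ C₂) (Fin 3)} (ht : t.leaves = (Finset.univ : Finset (Fin 3)).val)
    (h : ofTree (Sum.elim ε₁ ε₂) ∅ Finset.univ t ht ∈ F12 k ε₁ ε₂) :
    (Finsupp.single t 1 : TreeMod k _ _) ∈ relSet (combinedRel R₁ R₂ 0) := by
  refine ⟨single_mem_Homog ht 1, Submodule.mem_sup_left (Submodule.mem_sup_right ?_)⟩
  refine ⟨⟨_, h⟩, ?_⟩
  simp
  rfl

/-- For the trivial law each tree is normal or zero. -/
theorem isNormal_or_idealMem (R₁ : Submodule k (Free3 k ε₁)) (R₂ : Submodule k (Free3 k ε₂))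
    (t : BTree (C₁ ⊕ C₂) X) :
    t.IsNormal ∨ IdealMem (Sum.elim ε₁ ε₂) (relSet (combinedRel R₁ R₂ 0)) t.leaves
      (Finsupp.single t (1 : k)) := by
  have hsingle : ∀ t : BTree (C₁ ⊕ C₂) X, (Finsupp.single t 1 : TreeMod k _ _) ∈
      Homog k _ t.leaves := fun t => single_mem_Homog rfl 1
  induction t with
  | leaf x => exact .inl trivial
  | node c l r hl hr =>
    have eg : (Finsupp.single (BTree.node c l r) (1 : k)) =
      graft c (Finsupp.single l 1) (Finsupp.single r 1) := by rw [graft_single, one_mul]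
    rcases hl with hl | hl
    swap
    · rw [eg]
      exact .inr (IdealMem.graft_left c hl ⟨_, hsingle r⟩)
    rcases hr with hr | hr
    swap
    · rw [eg]
      exact .inr (IdealMem.graft_right c ⟨_, hsingle l⟩ hr)
    obtain c | c := c
    swap
    · exact .inl ⟨hl, hr⟩
    have hcases : ∀ t : BTree (C₁ ⊕ C₂) X, t.IsNormal → t.IsPure ∨
        ∃ c l r, t = .node (Sum.inr c) l r := by
      rintro (x | ⟨c | c, l, r⟩) h
      · exact .inl trivial
      · exact .inl ⟨rfl, h⟩
      · exact .inr ⟨c, l, r, rfl⟩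
    -- What remains is a root of the first kind over two normal subtrees. If both are pure, the tree
    -- is normal; otherwise it arises by substitution from μ(1, ν) or μ(ν, 1), which is a relation
    -- of the trivial law.
    rcases hcases l hl with hl | ⟨c', x, y, rfl⟩
    · rcases hcases r hr with hr | ⟨c', x, y, rfl⟩
      · exact .inl ⟨hl, hr⟩
      · right
        have ht : (BTree.node (Sum.inl c) (.leaf 0) (.node (Sum.inr c') (.leaf 1) (.leaf 2)) :
            BTree (C₁ ⊕ C₂) (Fin 3)).leaves = (Finset.univ : Finset (Fin 3)).val := by
          simp only [BTree.leaves, ← add_assoc]; rfl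
        have := IdealMem.rel (ε := Sum.elim ε₁ ε₂) (mem_relSet_of_mixed R₁ R₂ ht
          (Submodule.subset_span ⟨_, ht, rfl, _, _, 0, 1, 2, rfl, rfl, .inl rfl⟩))
          ![l.leaves, x.leaves, y.leaves]
          (fun i => ⟨(![Finsupp.single l 1, Finsupp.single x 1, Finsupp.single y 1] :
            Fin 3 → TreeMod k _ _) i, by fin_cases i <;> exact hsingle _⟩)
        simpa [evalTree, BTree.leaves, add_assoc] using this
    · right
      have ht : (BTree.node (Sum.inl c) (.node (Sum.inr c') (.leaf 0) (.leaf 1)) (.leaf 2) :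
          BTree (C₁ ⊕ C₂) (Fin 3)).leaves = (Finset.univ : Finset (Fin 3)).val := by
        simp only [BTree.leaves]; rfl
      have := IdealMem.rel (ε := Sum.elim ε₁ ε₂) (mem_relSet_of_mixed R₁ R₂ ht
        (Submodule.subset_span ⟨_, ht, rfl, _, _, 0, 1, 2, rfl, rfl, .inr rfl⟩))
        ![x.leaves, y.leaves, r.leaves]
        (fun i => ⟨(![Finsupp.single x 1, Finsupp.single y 1, Finsupp.single r 1] :
          Fin 3 → TreeMod k _ _) i, by fin_cases i <;> exact hsingle _⟩)
      simpa [evalTree, BTree.leaves] using this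

theorem xiLaw_zero_surjective (R₁ : Submodule k (Free3 k ε₁)) (R₂ : Submodule k (Free3 k ε₂))
    (n : ℕ) : Function.Surjective (xiLaw R₁ R₂ 0 n) := by
  intro y
  obtain ⟨⟨x, hx⟩, rfl⟩ := Op.mk_surjective _ _ _ y
  suffices h : ∃ z, ∃ h, xiLaw R₁ R₂ 0 n z = Op.mk _ _ _ (Comp.mk x h) by
    obtain ⟨z, _, h⟩ := h
    exact ⟨z, h⟩
  refine Homog_induction (p := fun x => ∃ z, ∃ h, xiLaw R₁ R₂ 0 n z = Op.mk _ _ _ (Comp.mk x h))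
    ?_ ?_ ?_ ?_ hx
  · intro t ht
    rcases isNormal_or_idealMem R₁ R₂ t with h | h
    · obtain ⟨z, hz⟩ := exists_xiLaw_eq_ofTree R₁ R₂ h ht
      exact ⟨z, _, hz 0⟩
    · refine ⟨0, single_mem_Homog ht 1, ?_⟩
      rw [map_zero, eq_comm, Op.mk_eq_zero]
      rw [ht] at h
      exact h
  · exact ⟨0, zero_mem _, by rw [map_zero]; exact (map_zero _).symm⟩
  · rintro x y ⟨z, hx, hz⟩ ⟨z', hy, hz'⟩
    exact ⟨z + z', add_mem hx hy, by rw [map_add, hz, hz', ← map_add]; rfl⟩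
  · rintro r x ⟨z, hx, hz⟩
    exact ⟨r • z, Submodule.smul_mem _ r hx, by rw [map_smul, hz, ← map_smul]; rfl⟩

end NormalTrees

/-! ### Injectivity for the trivial law -/

section Injectivity

variable {k : Type u} [Field k] {C₁ C₂ C X : Type}

theorem evalAlg_congr {A : Type v} [AddCommGroup A] [Module k A] (op : C → A →ₗ[k] A →ₗ[k] A)
    {s s' : X → A} {m : Multiset X} (h : ∀ i ∈ m, s i = s' i) {x : TreeMod k C X}
    (hx : x ∈ Homog k C m) : evalAlg op s x = evalAlg op s' x := by
  refine Homog_induction (p := fun x => evalAlg op s x = evalAlg op s' x) ?_ (by simp)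
    (fun x y h h' => by simp [h, h']) (fun a x h => by simp [h]) hx
  rintro t rfl
  rw [evalAlg_single, evalAlg_single]
  congr 1
  clear hx
  induction t with
  | leaf y => exact h y (by simp [BTree.leaves])
  | node c l r hl hr =>
    rw [treeVal, treeVal, hl fun i hi => h i (by simp [BTree.leaves, hi]),
      hr fun i hi => h i (by simp [BTree.leaves, hi])]

/-- Each leaf of a tree contributes its scalar once, so rescaling the variables acts on a
multidegree by a single scalar. -/
theorem subst_smul_leaf (g : X → k) {m : Multiset X} {x : TreeMod k C X} (hx : x ∈ Homog k C m) :
    subst (fun i => g i • (Finsupp.single (BTree.leaf i) 1 : TreeMod k C X)) x =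
      (m.map g).prod • x := by
  refine Homog_induction (p := fun x => subst (fun i =>
    g i • (Finsupp.single (BTree.leaf i) 1 : TreeMod k C X)) x = (m.map g).prod • x) ?_ (by simp)
    (fun x y h h' => by simp only [map_add, smul_add, h, h'])
    (fun a x h => by simp only [map_smul, h, smul_comm a]) hx
  rintro t rfl
  rw [subst_single, one_smul]
  clear hx
  induction t with
  | leaf y => simp [evalTree, BTree.leaves]
  | node c l r hl hr =>
    rw [evalTree, hl, hr, map_smul, map_smul, LinearMap.smul_apply, graft_single, one_mul,
      smul_smul, BTree.leaves, Multiset.map_add, Multiset.prod_add, mul_comm]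

theorem subst_leaf (x : TreeMod k C X) :
    subst (fun i => (Finsupp.single (BTree.leaf i) 1 : TreeMod k C X)) x = x := by
  induction x using Finsupp.induction_linear with
  | zero => simp
  | add x x' h h' => simp [h, h']
  | single t a =>
    have := subst_smul_leaf (fun _ => 1) (single_mem_Homog (C := C) (t := t) rfl a)
    simpa using this

variable {ε₁ : C₁ → ℤˣ} {ε₂ : C₂ → ℤˣ} (R₁ : Submodule k (Free3 k ε₁))
  (R₂ : Submodule k (Free3 k ε₂))

/-- The map from the free algebra on `X` to the free algebra on the blocks of `π` which maps the
component at the block `B` to multiples of the generator `B`. -/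
noncomputable def blockMap [DecidableEq X] {S : Finset X} (π : Finpartition S)
    (φ : ∀ B : π.parts, QuadOp R₁ B.1 →ₗ[k] k) :
    FreeAlg ε₁ (relSet R₁) X →ₗ[k] FreeAlg ε₂ (relSet R₂) (Finset X) :=
  ∑ B : π.parts, (φ B ∘ₗ FreeAlg.toOp ε₁ mem_Homog_of_mem_relSet B.1).smulRight
    ((totalIdeal ε₂ (relSet R₂) (Finset X)).mkQ (Finsupp.single (.leaf B.1) 1))

/-- Distinct blocks are distinct multidegrees, so only the summand of `B` contributes. -/
theorem blockMap_mk [DecidableEq X] {S : Finset X} (π : Finpartition S)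
    (φ : ∀ B : π.parts, QuadOp R₁ B.1 →ₗ[k] k) (B : π.parts) (x : Comp k C₁ B.1) :
    blockMap R₁ R₂ π φ ((totalIdeal ε₁ (relSet R₁) X).mkQ x.val) =
      φ B (Op.mk _ _ _ x) • (totalIdeal ε₂ (relSet R₂) (Finset X)).mkQ
        (Finsupp.single (.leaf B.1) 1) := by
  rw [blockMap, LinearMap.sum_apply, Finset.sum_eq_single B]
  · rw [LinearMap.smulRight_apply, LinearMap.comp_apply, FreeAlg.toOp_mk]
  · intro B' _ hne
    rw [LinearMap.smulRight_apply, LinearMap.comp_apply, FreeAlg.toOp_mk_of_ne _ _ _ _ x.val_mem,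
      map_zero, zero_smul]
    exact fun h => hne (Subtype.ext (Finset.val_injective h)).symm
  · simp

/-- The functional on the operad of the trivial law that is given by functionals on the components
of `P₂[π]` and `P₁[B]`. -/
noncomputable def blockFunctional {n : ℕ} (π : Finpartition (Finset.univ : Finset (Fin n)))
    (ψ : QuadOp R₂ π.parts →ₗ[k] k) (φ : ∀ B : π.parts, QuadOp R₁ B.1 →ₗ[k] k) :
    QuadOp (combinedRel R₁ R₂ 0) (Finset.univ : Finset (Fin n)) →ₗ[k] k :=
  ψ ∘ₗ FreeAlg.toOp ε₂ mem_Homog_of_mem_relSet π.parts ∘ₗ LinearMap.snd k _ _ ∘ₗ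
    evalOp (isSymm_mixOp (blockMap R₁ R₂ π φ) (isSymm_freeOp ε₁ (relSet R₁) (Fin n))
        (isSymm_freeOp ε₂ (relSet R₂) (Finset (Fin n))))
      (satRel_mixOp (blockMap R₁ R₂ π φ) (isSymm_freeOp ε₁ (relSet R₁) (Fin n))
        (isSymm_freeOp ε₂ (relSet R₂) (Finset (Fin n)))
        (satRel_freeOp ε₁ mem_Homog_of_mem_relSet (Fin n))
        (satRel_freeOp ε₂ mem_Homog_of_mem_relSet (Finset (Fin n)))) Finset.univ
      (fun i => ((totalIdeal ε₁ (relSet R₁) (Fin n)).mkQ (Finsupp.single (.leaf i) 1),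
        blockMap R₁ R₂ π φ
          ((totalIdeal ε₁ (relSet R₁) (Fin n)).mkQ (Finsupp.single (.leaf i) 1))))

/-- The variables were sent to the graph of `blockMap`, so the second component of each inner tree
is the image under `blockMap` of its class in the free algebra. The outer tree then works in the
free algebra on sets of variables. -/
theorem blockFunctional_mk_gammaComp {n : ℕ}
    (π π' : Finpartition (Finset.univ : Finset (Fin n)))
    (ψ : QuadOp R₂ π.parts →ₗ[k] k) (φ : ∀ B : π.parts, QuadOp R₁ B.1 →ₗ[k] k)
    (x : Comp k C₂ π'.parts) (s : ∀ B : π'.parts, Comp k C₁ B.1) :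
    blockFunctional R₁ R₂ π ψ φ (Op.mk _ _ _ (gammaComp π' (Comp.recolor Sum.inr π'.parts x)
      fun B => Comp.recolor Sum.inl B.1 (s B))) =
    ψ (FreeAlg.toOp ε₂ mem_Homog_of_mem_relSet π.parts
      (evalAlg (freeOp ε₂ (relSet R₂) (Finset (Fin n))) (fun B => if h : B ∈ π'.parts then
        blockMap R₁ R₂ π φ ((totalIdeal ε₁ (relSet R₁) (Fin n)).mkQ (s ⟨B, h⟩).val) else 0)
        x.val)) := by
  rw [blockFunctional]
  simp only [LinearMap.comp_apply]
  have e : (gammaComp π' (Comp.recolor (Sum.inr : C₂ → C₁ ⊕ C₂) π'.parts x)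
      fun B => Comp.recolor Sum.inl B.1 (s B)).val =
    subst (blockFun π' fun B => Comp.recolor Sum.inl B.1 (s B)) (recolorLin Sum.inr x.val) := rfl
  rw [evalOp_mk, e, LinearMap.snd_apply, evalAlg_subst, evalAlg_recolorLin, snd_evalAlg_mixOp_inr]
  congr 3
  refine congrArg _ (funext fun B => ?_)
  rw [blockFun]
  split_ifs with h
  · rw [Comp.val_recolor, evalAlg_recolorLin, evalAlg_mixOp_inl_of_graph _ _ fun _ => rfl]
    congr 1
    rw [evalAlg_freeOp, subst_leaf]
  · rw [map_zero]; rfl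

/-- A block `B` of `π'` is sent to a multiple of the generator `B`, the multiple being 0 unless `B`
is a block of `π`. The value is therefore a multiple of the class of `x`, whose multidegree
`π'.parts` is not the one that `π` projects to. -/
theorem blockFunctional_of_ne {n : ℕ} {π π' : Finpartition (Finset.univ : Finset (Fin n))}
    (hne : π' ≠ π) (ψ : QuadOp R₂ π.parts →ₗ[k] k) (φ : ∀ B : π.parts, QuadOp R₁ B.1 →ₗ[k] k)
    (x : Comp k C₂ π'.parts) (s : ∀ B : π'.parts, Comp k C₁ B.1) :
    blockFunctional R₁ R₂ π ψ φ (Op.mk _ _ _ (gammaComp π' (Comp.recolor Sum.inr π'.parts x)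
      fun B => Comp.recolor Sum.inl B.1 (s B))) = 0 := by
  classical
  rw [blockFunctional_mk_gammaComp]
  obtain ⟨g, hg⟩ : ∃ g : Finset (Fin n) → k, ∀ B ∈ π'.parts,
      (if h : B ∈ π'.parts then
        blockMap R₁ R₂ π φ ((totalIdeal ε₁ (relSet R₁) (Fin n)).mkQ (s ⟨B, h⟩).val) else 0) =
      (totalIdeal ε₂ (relSet R₂) (Finset (Fin n))).mkQ (g B • Finsupp.single (.leaf B) 1) := by
    suffices h : ∀ B, ∃ a : k, B ∈ π'.parts → (if h : B ∈ π'.parts then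
        blockMap R₁ R₂ π φ ((totalIdeal ε₁ (relSet R₁) (Fin n)).mkQ (s ⟨B, h⟩).val) else 0) =
      (totalIdeal ε₂ (relSet R₂) (Finset (Fin n))).mkQ (a • Finsupp.single (.leaf B) 1) by
      choose g hg using h
      exact ⟨g, hg⟩
    intro B
    by_cases hB' : B ∈ π'.parts
    · by_cases hB : B ∈ π.parts
      · refine ⟨φ ⟨B, hB⟩ (Op.mk _ _ _ (s ⟨B, hB'⟩)), fun _ => ?_⟩
        rw [dif_pos hB', map_smul]
        exact blockMap_mk R₁ R₂ π φ ⟨B, hB⟩ (s ⟨B, hB'⟩)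
      · refine ⟨0, fun _ => ?_⟩
        rw [dif_pos hB', zero_smul, map_zero, blockMap, LinearMap.sum_apply]
        refine Finset.sum_eq_zero fun B₁ _ => ?_
        rw [LinearMap.smulRight_apply, LinearMap.comp_apply,
          FreeAlg.toOp_mk_of_ne _ _ _ _ (s ⟨B, hB'⟩).val_mem, map_zero, zero_smul]
        intro h
        obtain rfl : B = B₁.1 := Finset.val_injective h
        exact hB B₁.2
    · exact ⟨0, fun h => absurd h hB'⟩
  rw [evalAlg_congr _ hg x.val_mem, evalAlg_freeOp, subst_smul_leaf _ x.val_mem, map_smul,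
    map_smul, FreeAlg.toOp_mk_of_ne _ _ _ _ x.val_mem, smul_zero, map_zero]
  exact fun h => hne (Finpartition.ext (Finset.val_injective h))

/-- Here the scalars `φ B` factor out of the outer element, whose own class survives the projection.
-/
theorem blockFunctional_self {n : ℕ} (π : Finpartition (Finset.univ : Finset (Fin n)))
    (ψ : QuadOp R₂ π.parts →ₗ[k] k) (φ : ∀ B : π.parts, QuadOp R₁ B.1 →ₗ[k] k)
    (x : Comp k C₂ π.parts) (s : ∀ B : π.parts, Comp k C₁ B.1) :
    blockFunctional R₁ R₂ π ψ φ (Op.mk _ _ _ (gammaComp π (Comp.recolor Sum.inr π.parts x)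
      fun B => Comp.recolor Sum.inl B.1 (s B))) =
    ψ (Op.mk _ _ _ x) * ∏ B : π.parts, φ B (Op.mk _ _ _ (s B)) := by
  classical
  rw [blockFunctional_mk_gammaComp]
  let g : Finset (Fin n) → k := fun B =>
    if h : B ∈ π.parts then φ ⟨B, h⟩ (Op.mk _ _ _ (s ⟨B, h⟩)) else 0
  have hg : ∀ B ∈ π.parts, (if h : B ∈ π.parts then
        blockMap R₁ R₂ π φ ((totalIdeal ε₁ (relSet R₁) (Fin n)).mkQ (s ⟨B, h⟩).val) else 0) =
      (totalIdeal ε₂ (relSet R₂) (Finset (Fin n))).mkQ (g B • Finsupp.single (.leaf B) 1) := by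
    intro B hB
    rw [dif_pos hB, map_smul]
    simp only [g, dif_pos hB]
    exact blockMap_mk R₁ R₂ π φ ⟨B, hB⟩ (s ⟨B, hB⟩)
  rw [evalAlg_congr _ hg x.val_mem, evalAlg_freeOp, subst_smul_leaf _ x.val_mem, map_smul,
    map_smul, FreeAlg.toOp_mk, map_smul, smul_eq_mul, mul_comm]
  congr 1
  change ∏ B ∈ π.parts, g B = _
  rw [← Finset.prod_coe_sort]
  refine Finset.prod_congr rfl fun B _ => ?_
  simp [g]

/-- Each coordinate of an element of the composite, in bases of tensor products, is a block
functional applied to its image under ξ, so an element of the kernel has only zero coordinates. -/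
theorem xiLaw_zero_injective (n : ℕ) : Function.Injective (xiLaw R₁ R₂ 0 n) := by
  classical
  rw [injective_iff_map_eq_zero]
  intro z hz
  refine DFinsupp.ext fun π => ?_
  let b₂ := Module.Free.chooseBasis k (QuadOp R₂ π.parts)
  let b₁ := fun B : π.parts => Module.Free.chooseBasis k (QuadOp R₁ B.1)
  let b := b₂.tensorProduct (Basis.piTensorProduct b₁)
  refine b.ext_elem fun p => ?_
  -- Both sides are linear, so pure elements suffice: for the same partition both are the product of
  -- the coordinates of the factors, for another partition both are 0.
  have key : b.coord p ∘ₗ DirectSum.component k (Finpartition (Finset.univ : Finset (Fin n)))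
      (fun π => QuadOp R₂ π.parts ⊗[k] (⨂[k] B : π.parts, QuadOp R₁ B.1)) π =
      blockFunctional R₁ R₂ π (b₂.coord p.1) (fun B => (b₁ B).coord (p.2 B)) ∘ₗ
        xiLaw R₁ R₂ 0 n := by
    refine DirectSum.linearMap_ext _ fun π' => ?_
    refine TensorProduct.ext (LinearMap.ext fun x => PiTensorProduct.ext ?_)
    refine MultilinearMap.ext fun s => ?_
    obtain ⟨x, rfl⟩ := Op.mk_surjective _ _ _ x
    choose s' hs' using fun B => Op.mk_surjective _ _ _ (s B)
    obtain rfl : (fun B => Op.mk _ _ _ (s' B)) = s := funext hs'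
    have h := xiLaw_pureComposite (R₁ := R₁) (R₂ := R₂) (D := 0) π' x s'
    change b.coord p (DirectSum.component k _ _ π (pureComposite π' (Op.mk _ _ _ x)
      fun B => Op.mk _ _ _ (s' B))) =
      blockFunctional R₁ R₂ π (b₂.coord p.1) (fun B => (b₁ B).coord (p.2 B))
      (xiLaw R₁ R₂ 0 n (pureComposite π' (Op.mk _ _ _ x) fun B => Op.mk _ _ _ (s' B)))
    rw [h]
    by_cases hne : π' = π
    · subst hne
      rw [blockFunctional_self, pureComposite, DirectSum.component.lof_self, Module.Basis.coord_apply,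
        Module.Basis.tensorProduct_repr_tmul_apply, Basis.piTensorProduct_repr_tprod_apply]
      simp only [smul_eq_mul, Module.Basis.coord_apply, mul_comm]
    · rw [blockFunctional_of_ne _ _ hne, pureComposite, DirectSum.component.of, dif_neg hne, map_zero]
  have := LinearMap.congr_fun key z
  rw [LinearMap.comp_apply, LinearMap.comp_apply, hz, map_zero] at this
  exact this

end Injectivity

theorem xiLaw_zero_bijective {k : Type u} [Field k] {C₁ C₂ : Type} {ε₁ : C₁ → ℤˣ} {ε₂ : C₂ → ℤˣ}
    (R₁ : Submodule k (Free3 k ε₁)) (R₂ : Submodule k (Free3 k ε₂)) (n : ℕ) :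
    Function.Bijective (xiLaw R₁ R₂ 0 n) :=
  ⟨xiLaw_zero_injective R₁ R₂ n, xiLaw_zero_surjective R₁ R₂ n⟩

/-- The trivial law is a distributive law. -/
theorem isDistributiveLaw_zero {k : Type u} [Field k] {C₁ C₂ : Type} {ε₁ : C₁ → ℤˣ}
    {ε₂ : C₂ → ℤˣ} (R₁ : Submodule k (Free3 k ε₁)) (R₂ : Submodule k (Free3 k ε₂)) :
    IsDistributiveLaw R₁ R₂ 0 :=
  ⟨fun σ x => by simp, fun n _ => xiLaw_zero_bijective R₁ R₂ n⟩

/-! ### Laws between operads with one generating operation -/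

section OneOperation

variable {k : Type u} [Field k] (e : ℤˣ)

/-- The tree `μ(σ 0, ν(σ 1, σ 2))`. -/
abbrev mixedTree (μ ν : Unit ⊕ Unit) (σ : Equiv.Perm (Fin 3)) : BTree (Unit ⊕ Unit) (Fin 3) :=
  .node μ (.leaf (σ 0)) (.node ν (.leaf (σ 1)) (.leaf (σ 2)))

theorem leaves_mixedTree (μ ν : Unit ⊕ Unit) (σ : Equiv.Perm (Fin 3)) :
    (mixedTree μ ν σ).leaves = (Finset.univ : Finset (Fin 3)).val := by
  rw [← bind_perm σ, show (Finset.univ : Finset (Fin 3)).val = {0} + {1} + {2} from rfl]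
  simp only [BTree.leaves, Multiset.add_bind, Multiset.singleton_bind, add_assoc]

/-- The signs of two operations with the same symmetry `e`. -/
abbrev sumSign : Unit ⊕ Unit → ℤˣ := Sum.elim (fun _ : Unit => e) (fun _ : Unit => e)

/-- The class of `μ(σ 0, ν(σ 1, σ 2))`. -/
noncomputable def mixedClass (k : Type u) [Field k] (e : ℤˣ) (μ ν : Unit ⊕ Unit)
    (σ : Equiv.Perm (Fin 3)) : Free3 k (sumSign e) :=
  ofTree (sumSign e) ∅ Finset.univ (mixedTree μ ν σ) (leaves_mixedTree μ ν σ)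

theorem sumSign_apply (c : Unit ⊕ Unit) : sumSign e c = e := by
  rcases c with c | c <;> rfl

theorem mixedClass_mem_mixed {p q : Unit ⊕ Unit → Prop} {μ ν : Unit ⊕ Unit} (hμ : p μ) (hν : q ν)
    (σ : Equiv.Perm (Fin 3)) : mixedClass k e μ ν σ ∈ mixed k (sumSign e) p q :=
  Submodule.subset_span ⟨_, leaves_mixedTree μ ν σ, rfl, μ, ν, _, _, _, hμ, hν, .inl rfl⟩

theorem act_mixedClass (μ ν : Unit ⊕ Unit) (σ τ : Equiv.Perm (Fin 3)) :
    act (sumSign e) ∅ τ (mixedClass k e μ ν σ) = mixedClass k e μ ν (τ * σ) :=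
  (act_ofTree (sumSign e) ∅ τ _ (leaves_mixedTree μ ν σ)).choose_spec

/-- Precomposition with the transposition exchanges the two arguments of the inner operation. -/
theorem mixedClass_mul_swap (μ ν : Unit ⊕ Unit) (σ : Equiv.Perm (Fin 3)) :
    mixedClass k e μ ν (σ * Equiv.swap 1 2) = ((e : ℤ) : k) • mixedClass k e μ ν σ := by
  rw [mixedClass, mixedClass, ofTree, ofTree, ← map_smul, ← sub_eq_zero, ← map_sub,
    Op.mk_eq_zero]
  have h := IdealMem.graft_right (R := ∅) μ
    ⟨Finsupp.single (.leaf (σ 0)) (1 : k), single_mem_Homog rfl 1⟩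
    (IdealMem.symm (ε := sumSign e) ν
      ⟨Finsupp.single (.leaf (σ 2)) (1 : k), single_mem_Homog rfl 1⟩
      ⟨Finsupp.single (.leaf (σ 1)) (1 : k), single_mem_Homog rfl 1⟩)
  have hl := leaves_mixedTree μ ν (σ * Equiv.swap 1 2)
  have e0 : (Equiv.swap (1 : Fin 3) 2) 0 = 0 := by decide
  simp only [BTree.leaves, Equiv.Perm.mul_apply, Equiv.swap_apply_left,
    Equiv.swap_apply_right, e0] at hl
  simp only [BTree.leaves, hl, sumSign_apply] at h
  change IdealMem _ _ _ (Finsupp.single (mixedTree μ ν (σ * Equiv.swap 1 2)) (1 : k) -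
    ((e : ℤ) : k) • Finsupp.single (mixedTree μ ν σ) (1 : k))
  convert h using 1
  simp [mixedTree, e0, -Finsupp.smul_single, -zsmul_eq_mul]

theorem ofTree_left (μ ν : Unit ⊕ Unit) (a b c : Fin 3)
    (h : (BTree.node μ (.node ν (.leaf a) (.leaf b)) (.leaf c)).leaves =
      (Finset.univ : Finset (Fin 3)).val)
    (h' : (BTree.node μ (.leaf c) (.node ν (.leaf a) (.leaf b))).leaves =
      (Finset.univ : Finset (Fin 3)).val) :
    ofTree (k := k) (sumSign e) ∅ Finset.univ _ h =
      ((e : ℤ) : k) • ofTree (sumSign e) ∅ Finset.univ _ h' := by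
  rw [ofTree, ofTree, ← map_smul, ← sub_eq_zero, ← map_sub, Op.mk_eq_zero]
  have g := IdealMem.symm (ε := sumSign e) (R := ∅) μ
      ⟨Finsupp.single (.node ν (.leaf a) (.leaf b)) (1 : k), single_mem_Homog rfl 1⟩
      ⟨Finsupp.single (.leaf c) (1 : k), single_mem_Homog rfl 1⟩
  simp only [BTree.leaves] at h
  simp only [BTree.leaves, h, sumSign_apply] at g
  change IdealMem _ _ _ (Finsupp.single (.node μ (.node ν (.leaf a) (.leaf b)) (.leaf c)) (1 : k) -
    ((e : ℤ) : k) • Finsupp.single (.node μ (.leaf c) (.node ν (.leaf a) (.leaf b))) (1 : k))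
  convert g using 1
  simp [-Finsupp.smul_single, -zsmul_eq_mul]

theorem exists_perm {a b c : Fin 3}
    (h : ({a} + ({b} + {c}) : Multiset (Fin 3)) = (Finset.univ : Finset (Fin 3)).val) :
    ∃ σ : Equiv.Perm (Fin 3), σ 0 = a ∧ σ 1 = b ∧ σ 2 = c := by
  revert a b c
  decide

/-- The symmetry of the outer operation reduces μ(ν(a, b), c) to μ(c, ν(a, b)). -/
theorem mixed_le_span {p q : Unit ⊕ Unit → Prop} {μ₀ ν₀ : Unit ⊕ Unit} (hp : ∀ μ, p μ → μ = μ₀)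
    (hq : ∀ ν, q ν → ν = ν₀) :
    mixed k (sumSign e) p q ≤ Submodule.span k (Set.range (mixedClass k e μ₀ ν₀)) := by
  refine Submodule.span_le.mpr ?_
  rintro _ ⟨t, ht, rfl, μ, ν, a, b, c, hμ, hν, h⟩
  obtain rfl := hp μ hμ
  obtain rfl := hq ν hν
  rcases h with rfl | rfl
  · obtain ⟨σ, rfl, rfl, rfl⟩ := exists_perm (by simpa only [BTree.leaves] using ht)
    exact Submodule.subset_span ⟨σ, rfl⟩
  · have h' : (BTree.node μ (.leaf c) (.node ν (.leaf a) (.leaf b))).leaves =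
        (Finset.univ : Finset (Fin 3)).val := by
      rw [← ht]
      simp only [BTree.leaves]
      abel
    obtain ⟨σ, rfl, rfl, rfl⟩ := exists_perm (by simpa only [BTree.leaves] using h')
    rw [ofTree_left e μ ν _ _ _ ht h']
    exact Submodule.smul_mem _ _ (Submodule.subset_span ⟨σ, rfl⟩)

theorem eq_inl_of_isLeft (c : Unit ⊕ Unit) (h : c.isLeft) : c = Sum.inl () := by
  obtain ⟨_, rfl⟩ := Sum.isLeft_iff.mp h
  rfl

theorem eq_inr_of_isRight (c : Unit ⊕ Unit) (h : c.isRight) : c = Sum.inr () := by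
  obtain ⟨_, rfl⟩ := Sum.isRight_iff.mp h
  rfl

/-- The rotations represent the left cosets of the subgroup generated by the transposition of 1 and
2, which changes a class only by the sign `e`. -/
theorem perm_three_cases (σ : Equiv.Perm (Fin 3)) :
    (σ = 1 ∨ σ = finRotate 3 ∨ σ = (finRotate 3)⁻¹) ∨ (σ = 1 * Equiv.swap 1 2 ∨
      σ = finRotate 3 * Equiv.swap 1 2 ∨ σ = (finRotate 3)⁻¹ * Equiv.swap 1 2) := by
  revert σ
  decide

theorem exists_coeff_of_mem_F21 {x : Free3 k (sumSign e)}
    (hx : x ∈ F21 k (fun _ : Unit => e) (fun _ : Unit => e)) :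
    ∃ a b c : k, x = a • mixedClass k e (.inr ()) (.inl ()) 1 +
      b • mixedClass k e (.inr ()) (.inl ()) (finRotate 3) +
      c • mixedClass k e (.inr ()) (.inl ()) (finRotate 3)⁻¹ := by
  have h : x ∈ Submodule.span k {mixedClass k e (.inr ()) (.inl ()) 1,
      mixedClass k e (.inr ()) (.inl ()) (finRotate 3),
      mixedClass k e (.inr ()) (.inl ()) (finRotate 3)⁻¹} := by
    refine Submodule.span_le.mpr ?_ (mixed_le_span e eq_inr_of_isRight eq_inl_of_isLeft hx)
    rintro _ ⟨σ, rfl⟩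
    rcases perm_three_cases σ with (rfl | rfl | rfl) | (rfl | rfl | rfl)
    · exact Submodule.subset_span (by simp)
    · exact Submodule.subset_span (by simp)
    · exact Submodule.subset_span (by simp)
    all_goals
      rw [mixedClass_mul_swap]
      exact Submodule.smul_mem _ _ (Submodule.subset_span (by simp))
  obtain ⟨a, b, c, h⟩ := Submodule.mem_span_triple.mp h
  exact ⟨a, b, c, h.symm⟩

/-- The element `σ 0 · (σ 1 * σ 2)` of `F(E)(3)₁₂`. -/
noncomputable def gen12 (k : Type u) [Field k] (e : ℤˣ) (σ : Equiv.Perm (Fin 3)) :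
    F12 k (fun _ : Unit => e) (fun _ : Unit => e) :=
  ⟨mixedClass k e (.inl ()) (.inr ()) σ, mixedClass_mem_mixed (p := fun c => c.isLeft)
    (q := fun c => c.isRight) e (μ := .inl ()) (ν := .inr ()) rfl rfl σ⟩

variable {e}

/-- An equivariant map is determined by two coefficients. -/
theorem exists_coeff [CharZero k] {D : F12 k (fun _ : Unit => e) (fun _ : Unit => e) →ₗ[k]
      F21 k (fun _ : Unit => e) (fun _ : Unit => e)}
    (hD : ∀ (σ : Equiv.Perm (Fin 3)) (x : F12 k (fun _ : Unit => e) (fun _ : Unit => e)),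
      (D ⟨act _ ∅ σ x, act_mem_mixed σ x.2⟩ : Free3 k (sumSign e)) = act _ ∅ σ (D x)) :
    ∃ α β : k, (D (gen12 k e 1) : Free3 k (sumSign e)) =
      α • mixedClass k e (.inr ()) (.inl ()) 1 +
      β • (mixedClass k e (.inr ()) (.inl ()) (finRotate 3) +
        mixedClass k e (.inr ()) (.inl ()) (finRotate 3)⁻¹) := by
  obtain ⟨a, b, c, h⟩ := exists_coeff_of_mem_F21 e (D (gen12 k e 1)).2
  have hs := hD (Equiv.swap 1 2) (gen12 k e 1)
  -- The generator x·(y*z) is an eigenvector of the exchange of y and z, so its image is one too,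
  -- with the same sign.
  have hx : (⟨act _ ∅ (Equiv.swap 1 2) (gen12 k e 1).1, act_mem_mixed _ (gen12 k e 1).2⟩ :
      F12 k (fun _ : Unit => e) (fun _ : Unit => e)) = ((e : ℤ) : k) • gen12 k e 1 := by
    refine Subtype.ext ?_
    refine (act_mixedClass e (.inl ()) (.inr ()) 1 (Equiv.swap 1 2)).trans ?_
    rw [show Equiv.swap (1 : Fin 3) 2 * 1 = 1 * Equiv.swap 1 2 by decide, mixedClass_mul_swap]
    rfl
  rw [hx, map_smul, Submodule.coe_smul, h] at hs
  simp only [map_add, map_smul] at hs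
  rw [act_mixedClass, act_mixedClass, act_mixedClass,
    show Equiv.swap (1 : Fin 3) 2 * 1 = 1 * Equiv.swap 1 2 by decide,
    show Equiv.swap (1 : Fin 3) 2 * finRotate 3 = (finRotate 3)⁻¹ * Equiv.swap 1 2 by decide,
    show Equiv.swap (1 : Fin 3) 2 * (finRotate 3)⁻¹ = finRotate 3 * Equiv.swap 1 2 by decide,
    mixedClass_mul_swap, mixedClass_mul_swap, mixedClass_mul_swap] at hs
  -- The exchange of y and z swaps the last two classes up to `e`. Averaging the image with its
  -- exchanged form avoids a proof that the three classes are linearly independent; it needs 2 to be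
  -- invertible.
  refine ⟨a, (b + c) / 2, ?_⟩
  rw [h]
  generalize mixedClass k e (.inr ()) (.inl ()) 1 = y₀ at *
  generalize mixedClass k e (.inr ()) (.inl ()) (finRotate 3) = y₁ at *
  generalize mixedClass k e (.inr ()) (.inl ()) (finRotate 3)⁻¹ = y₂ at *
  have he : ((e : ℤ) : k) * ((e : ℤ) : k) = 1 := by
    rw [← Int.cast_mul, Int.units_coe_mul_self, Int.cast_one]
  have hs' : b • y₁ + c • y₂ = b • y₂ + c • y₁ := by
    have h1 := smul_right_injective _ (left_ne_zero_of_mul_eq_one he)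
      (hs.trans (by module : _ = ((e : ℤ) : k) • (a • y₀ + (b • y₂ + c • y₁))))
    rw [add_assoc] at h1
    exact add_left_cancel h1
  have h2 : (2 : k) ≠ 0 := two_ne_zero
  rw [add_assoc]
  congr 1
  have : (2 : k) • (b • y₁ + c • y₂) = (2 : k) • (((b + c) / 2) • (y₁ + y₂)) := by
    rw [smul_smul, mul_div_cancel₀ _ h2, two_smul]
    nth_rewrite 2 [hs']
    module
  exact smul_right_injective _ h2 this

/-- The translates of this one generator span the domain, and `D` is equivariant. -/
theorem eq_zero_of_gen12 {D : F12 k (fun _ : Unit => e) (fun _ : Unit => e) →ₗ[k]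
      F21 k (fun _ : Unit => e) (fun _ : Unit => e)}
    (hD : ∀ (σ : Equiv.Perm (Fin 3)) (x : F12 k (fun _ : Unit => e) (fun _ : Unit => e)),
      (D ⟨act _ ∅ σ x, act_mem_mixed σ x.2⟩ : Free3 k (sumSign e)) = act _ ∅ σ (D x))
    (h : (D (gen12 k e 1) : Free3 k (sumSign e)) = 0) : D = 0 := by
  have hg : ∀ σ, D (gen12 k e σ) = 0 := by
    intro σ
    have hs := hD σ (gen12 k e 1)
    have hx : (⟨act _ ∅ σ (gen12 k e 1).1, act_mem_mixed _ (gen12 k e 1).2⟩ :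
        F12 k (fun _ : Unit => e) (fun _ : Unit => e)) = gen12 k e σ :=
      Subtype.ext ((act_mixedClass e (.inl ()) (.inr ()) 1 σ).trans (by rw [mul_one]; rfl))
    rw [hx, h, map_zero] at hs
    exact Subtype.ext hs
  refine LinearMap.ext fun ⟨x, hx⟩ => ?_
  have hx' := mixed_le_span e eq_inl_of_isLeft eq_inr_of_isRight hx
  have hle : Submodule.span k (Set.range (mixedClass k e (.inl ()) (.inr ()))) ≤
      (LinearMap.ker D).map (Submodule.subtype _) := by
    refine Submodule.span_le.mpr ?_
    rintro _ ⟨σ, rfl⟩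
    exact ⟨gen12 k e σ, hg σ, rfl⟩
  obtain ⟨y, hy, hyx⟩ := hle hx'
  obtain rfl : y = ⟨x, hx⟩ := Subtype.ext hyx
  exact hy

/-! ### Consequences of a law in algebras -/

variable {A : Type v} [AddCommGroup A] [Module k A]

/-- The right hand side `α x * (y · z) + β (y * (z · x) + z * (x · y))` of a law. -/
def lawRhs (dot star : A →ₗ[k] A →ₗ[k] A) (α β : k) (x y z : A) : A :=
  α • star x (dot y z) + β • (star y (dot z x) + star z (dot x y))

/-- This is the relation x - D x for the generator, evaluated in the algebra; the two nontrivial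
rotations of (x, y, z) give the two terms with coefficient β. -/
theorem law_of_satRel {R₁ R₂ : Submodule k (Free3 k fun _ : Unit => e)}
    {D : F12 k (fun _ : Unit => e) (fun _ : Unit => e) →ₗ[k]
      F21 k (fun _ : Unit => e) (fun _ : Unit => e)} {α β : k}
    (hD : (D (gen12 k e 1) : Free3 k (sumSign e)) =
      α • mixedClass k e (.inr ()) (.inl ()) 1 +
      β • (mixedClass k e (.inr ()) (.inl ()) (finRotate 3) +
        mixedClass k e (.inr ()) (.inl ()) (finRotate 3)⁻¹))
    {op : Unit ⊕ Unit → A →ₗ[k] A →ₗ[k] A} (hop : SatRel (relSet (combinedRel R₁ R₂ D)) op)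
    (x y z : A) :
    op (.inl ()) x (op (.inr ()) y z) = lawRhs (op (.inl ())) (op (.inr ())) α β x y z := by
  have hH : ∀ μ ν σ, (Finsupp.single (mixedTree μ ν σ) (1 : k)) ∈
      Homog k (Unit ⊕ Unit) (Finset.univ : Finset (Fin 3)).val := fun μ ν σ =>
    single_mem_Homog (leaves_mixedTree μ ν σ) 1
  have h := hop (Finsupp.single (mixedTree (.inl ()) (.inr ()) 1) (1 : k) -
    (α • Finsupp.single (mixedTree (.inr ()) (.inl ()) 1) (1 : k) +
      β • (Finsupp.single (mixedTree (.inr ()) (.inl ()) (finRotate 3)) (1 : k) +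
        Finsupp.single (mixedTree (.inr ()) (.inl ()) (finRotate 3)⁻¹) (1 : k)))) ?_ ![x, y, z]
  · have e1 : (finRotate 3) 0 = 1 := by decide
    have e2 : (finRotate 3) 1 = 2 := by decide
    have e3 : (finRotate 3) 2 = 0 := by decide
    have e4 : (finRotate 3)⁻¹ 0 = 2 := by decide
    have e5 : (finRotate 3)⁻¹ 1 = 0 := by decide
    have e6 : (finRotate 3)⁻¹ 2 = 1 := by decide
    rw [map_sub, sub_eq_zero] at h
    simp only [map_add, map_smul, evalAlg_single, one_smul, mixedTree, treeVal, e1, e2, e3, e4,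
      e5, e6, Equiv.Perm.one_apply] at h
    exact h
  · refine ⟨sub_mem (hH _ _ _) (add_mem (Submodule.smul_mem _ _ (hH _ _ _))
      (Submodule.smul_mem _ _ (add_mem (hH _ _ _) (hH _ _ _)))), ?_⟩
    refine Submodule.mem_sup_left (Submodule.mem_sup_right ⟨gen12 k e 1, ?_⟩)
    rw [LinearMap.sub_apply, LinearMap.comp_apply, Submodule.subtype_apply,
      Submodule.subtype_apply, hD]
    rfl

end OneOperation

/-! ### The obstructions in arity four -/

section ComAndLie

variable {k : Type u} [Field k]
variable {A : Type v} [AddCommGroup A] [Module k A] {B : Type w} [AddCommGroup B] [Module k B]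

/-- Naturality lets one expression be read in three places: among trees, in the free algebra of the
law, and in the algebras W × F. -/
theorem map_lawRhs {dot star : A →ₗ[k] A →ₗ[k] A} {dot' star' : B →ₗ[k] B →ₗ[k] B}
    (f : A →ₗ[k] B) (hd : ∀ x y, f (dot x y) = dot' (f x) (f y))
    (hs : ∀ x y, f (star x y) = star' (f x) (f y)) (α β : k) (x y z : A) :
    f (lawRhs dot star α β x y z) = lawRhs dot' star' α β (f x) (f y) (f z) := by
  simp [lawRhs, hd, hs]

/-- The difference of the normal forms of `(a · b) · (c * d)` and `a · (b · (c * d))`. -/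
def comObstruction (dot star : A →ₗ[k] A →ₗ[k] A) (α β : k) (a b c d : A) : A :=
  lawRhs dot star α β (dot a b) c d - (α • lawRhs dot star α β a b (dot c d) +
    β • (lawRhs dot star α β a c (dot d b) + lawRhs dot star α β a d (dot b c)))

/-- The sum of the normal forms of `[{a, b}, {c, d}]` and `[{c, d}, {a, b}]`. -/
def lieObstruction (dot star : A →ₗ[k] A →ₗ[k] A) (α β : k) (a b c d : A) : A :=
  (α • star (star a b) (dot c d) + β • (star c (lawRhs dot star α β d a b) -
      star d (lawRhs dot star α β c a b))) +
    (α • star (star c d) (dot a b) + β • (star a (lawRhs dot star α β b c d) -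
      star b (lawRhs dot star α β a c d)))

/-- The law is applied once to (a·b)·(c*d) and twice to a·(b·(c*d)). Associativity of `dot` equates
the results. -/
theorem comObstruction_eq_zero {dot star : A →ₗ[k] A →ₗ[k] A} {α β : k}
    (hassoc : ∀ x y z, dot (dot x y) z = dot x (dot y z))
    (h : ∀ x y z, dot x (star y z) = lawRhs dot star α β x y z) (a b c d : A) :
    comObstruction dot star α β a b c d = 0 := by
  have e : dot a (lawRhs dot star α β b c d) = α • lawRhs dot star α β a b (dot c d) +
      β • (lawRhs dot star α β a c (dot d b) + lawRhs dot star α β a d (dot b c)) := by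
    rw [← h a b, ← h a c, ← h a d, lawRhs]
    simp
  rw [comObstruction, ← e, ← h, ← h, hassoc, sub_self]

/-- The law is applied with {a,b} as first argument, then to [d,{a,b}] and [c,{a,b}]. Only the
antisymmetry of `dot` enters, not the Jacobi identity. -/
theorem lieObstruction_eq_zero {dot star : A →ₗ[k] A →ₗ[k] A} {α β : k}
    (hanti : ∀ x y, dot x y = -dot y x)
    (h : ∀ x y z, dot x (star y z) = lawRhs dot star α β x y z) (a b c d : A) :
    lieObstruction dot star α β a b c d = 0 := by
  have e : ∀ a b c d, α • star (star a b) (dot c d) + β • (star c (lawRhs dot star α β d a b) -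
      star d (lawRhs dot star α β c a b)) = dot (star a b) (star c d) := by
    intro a b c d
    rw [← h d, ← h c, h (star a b) c d, lawRhs, hanti (star a b) c, map_neg, sub_eq_add_neg]
  rw [lieObstruction, e, e, hanti, neg_add_cancel]

theorem map_comObstruction {dot star : A →ₗ[k] A →ₗ[k] A} {dot' star' : B →ₗ[k] B →ₗ[k] B}
    (f : A →ₗ[k] B) (hd : ∀ x y, f (dot x y) = dot' (f x) (f y))
    (hs : ∀ x y, f (star x y) = star' (f x) (f y)) (α β : k) (a b c d : A) :
    f (comObstruction dot star α β a b c d) =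
      comObstruction dot' star' α β (f a) (f b) (f c) (f d) := by
  simp [comObstruction, map_lawRhs f hd hs, hd]

theorem map_lieObstruction {dot star : A →ₗ[k] A →ₗ[k] A} {dot' star' : B →ₗ[k] B →ₗ[k] B}
    (f : A →ₗ[k] B) (hd : ∀ x y, f (dot x y) = dot' (f x) (f y))
    (hs : ∀ x y, f (star x y) = star' (f x) (f y)) (α β : k) (a b c d : A) :
    f (lieObstruction dot star α β a b c d) =
      lieObstruction dot' star' α β (f a) (f b) (f c) (f d) := by
  simp [lieObstruction, map_lawRhs f hd hs, hd, hs]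

/-- The leaf `i` as a combination of trees. -/
noncomputable abbrev leaf4 (k : Type u) [Field k] (i : Fin 4) :
    TreeMod k (Unit ⊕ Unit) (Fin 4) :=
  Finsupp.single (.leaf i) 1

theorem evalAlg_leaf4 (op : Unit ⊕ Unit → A →ₗ[k] A →ₗ[k] A) (s : Fin 4 → A) (i : Fin 4) :
    evalAlg op s (leaf4 k i) = s i := by
  rw [evalAlg_single, one_smul, treeVal]

theorem single_mem_normalSpan {C₁ C₂ : Type} {n : ℕ} {t : BTree (C₁ ⊕ C₂) (Fin n)}
    (h : t.IsNormal) (ht : t.leaves = (Finset.univ : Finset (Fin n)).val) :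
    Finsupp.single t 1 ∈ normalSpan k C₁ C₂ n :=
  Submodule.subset_span ⟨t, h, ht, rfl⟩

/-- After expansion each term has one `star` at its root and only `dot` inside its arguments. -/
theorem comObstruction_mem_normalSpan (α β : k) :
    comObstruction (graft (.inl ())) (graft (.inr ())) α β (leaf4 k 0) (leaf4 k 1) (leaf4 k 2)
      (leaf4 k 3) ∈ normalSpan k Unit Unit 4 := by
  simp only [comObstruction, lawRhs, graft_single, one_mul]
  repeat' first
    | with_reducible apply sub_mem
    | with_reducible apply add_mem
    | with_reducible apply Submodule.smul_mem
    | with_reducible apply single_mem_normalSpan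
  all_goals first
    | simp [BTree.IsNormal, BTree.IsPure]
    | decide

/-- Here each term has two nested `star`s or a `star` of a `star` and a `dot`, but never a `star`
inside a `dot`. -/
theorem lieObstruction_mem_normalSpan (α β : k) :
    lieObstruction (graft (.inl ())) (graft (.inr ())) α β (leaf4 k 0) (leaf4 k 1) (leaf4 k 2)
      (leaf4 k 3) ∈ normalSpan k Unit Unit 4 := by
  simp only [lieObstruction, lawRhs, graft_single, one_mul, map_add, map_smul]
  repeat' first
    | with_reducible apply sub_mem
    | with_reducible apply add_mem
    | with_reducible apply Submodule.smul_mem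
    | with_reducible apply single_mem_normalSpan
  all_goals first
    | simp [BTree.IsNormal, BTree.IsPure]
    | decide

/-- In a quotient of the free operad on `E ⊕ E` by a law, the operations of the first kind satisfy
the relations of the first operad. -/
theorem satRel_inl {C₁ C₂ : Type} {ε₁ : C₁ → ℤˣ} {ε₂ : C₂ → ℤˣ} {R₁ : Submodule k (Free3 k ε₁)}
    {R₂ : Submodule k (Free3 k ε₂)} {D : F12 k ε₁ ε₂ →ₗ[k] F21 k ε₁ ε₂}
    {op : C₁ ⊕ C₂ → A →ₗ[k] A →ₗ[k] A} (h : SatRel (relSet (combinedRel R₁ R₂ D)) op) :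
    SatRel (relSet R₁) fun c => op (.inl c) := by
  intro r hr s
  rw [← evalAlg_recolorLin]
  exact h _ (inl_mem_combinedRel R₁ R₂ D r hr) s

theorem assoc_of_satRel {op : Unit → A →ₗ[k] A →ₗ[k] A} (h : SatRel (relSet (comRel k)) op)
    (x y z : A) : op () (op () x y) z = op () x (op () y z) := by
  have h1 : (leftComb 0 1 2).leaves = (Finset.univ : Finset (Fin 3)).val :=
    leaves_leftComb 1 0 1 2 rfl
  have h2 : (rightComb 0 1 2).leaves = (Finset.univ : Finset (Fin 3)).val :=
    leaves_rightComb 1 0 1 2 rfl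
  have := h (Finsupp.single (leftComb 0 1 2) 1 - Finsupp.single (rightComb 0 1 2) 1)
    ⟨sub_mem (single_mem_Homog h1 1) (single_mem_Homog h2 1), Submodule.subset_span ⟨1, rfl⟩⟩
    ![x, y, z]
  rw [map_sub, sub_eq_zero] at this
  simpa [treeVal] using this

/-- An associative operation is an operation of an algebra over `Com`. -/
theorem satRel_comRel {op : Unit → A →ₗ[k] A →ₗ[k] A} (hs : IsSymm comSign op)
    (h : ∀ x y z, op () (op () x y) z = op () x (op () y z)) : SatRel (relSet (comRel k)) op := by
  refine satRel_relSet hs fun s => Submodule.span_le.mpr ?_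
  rintro _ ⟨σ, rfl⟩
  refine LinearMap.mem_ker.mpr ?_
  rw [map_sub, evalOp_ofTree, evalOp_ofTree, sub_eq_zero]
  exact h _ _ _

/-- An operation that satisfies the Jacobi identity is an operation of an algebra over `Lie`. -/
theorem satRel_lieRel {op : Unit → A →ₗ[k] A →ₗ[k] A} (hs : IsSymm lieSign op)
    (h : ∀ x y z, op () (op () x y) z + op () (op () y z) x + op () (op () z x) y = 0) :
    SatRel (relSet (lieRel k)) op := by
  refine satRel_relSet hs fun s => Submodule.span_le.mpr ?_
  rintro _ ⟨σ, rfl⟩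
  refine LinearMap.mem_ker.mpr ?_
  rw [map_add, map_add, evalOp_ofTree, evalOp_ofTree, evalOp_ofTree]
  exact h _ _ _

/-- A normal combination of trees that vanishes in the algebras over the operad of a distributive
law vanishes in the algebras over the operad of the trivial law. -/
theorem evalAlg_mixOp_eq_zero {ε₁ ε₂ : Unit → ℤˣ} {R₁ : Submodule k (Free3 k ε₁)}
    {R₂ : Submodule k (Free3 k ε₂)} {D : F12 k ε₁ ε₂ →ₗ[k] F21 k ε₁ ε₂}
    (hD : IsDistributiveLaw R₁ R₂ D) {x : TreeMod k (Unit ⊕ Unit) (Fin 4)}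
    (hx : x ∈ normalSpan k Unit Unit 4)
    (h : x ∈ totalIdeal (Sum.elim ε₁ ε₂) (relSet (combinedRel R₁ R₂ D)) (Fin 4))
    {op₁ : Unit → A →ₗ[k] A →ₗ[k] A} {op₂ : Unit → B →ₗ[k] B →ₗ[k] B} (φ : A →ₗ[k] B)
    (h₁ : IsSymm ε₁ op₁) (h₂ : IsSymm ε₂ op₂) (hR₁ : SatRel (relSet R₁) op₁)
    (hR₂ : SatRel (relSet R₂) op₂) (s : Fin 4 → A × B) : evalAlg (mixOp op₁ op₂ φ) s x = 0 :=
  evalAlg_eq_zero (isSymm_mixOp φ h₁ h₂) (satRel_mixOp φ h₁ h₂ hR₁ hR₂) s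
    (idealMem_trivial_of_injective (hD.2 4 (by norm_num)).1 hx h)

/-- The obstruction for laws between operads with an associative operation vanishes in the algebras
over the operad of the trivial law. -/
theorem comObstruction_mixOp {e : ℤˣ} {R₁ R₂ : Submodule k (Free3 k fun _ : Unit => e)}
    {D : F12 k (fun _ : Unit => e) (fun _ : Unit => e) →ₗ[k]
      F21 k (fun _ : Unit => e) (fun _ : Unit => e)}
    (hD : IsDistributiveLaw R₁ R₂ D) {α β : k}
    (hc : (D (gen12 k e 1) : Free3 k (sumSign e)) =
      α • mixedClass k e (.inr ()) (.inl ()) 1 +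
      β • (mixedClass k e (.inr ()) (.inl ()) (finRotate 3) +
        mixedClass k e (.inr ()) (.inl ()) (finRotate 3)⁻¹))
    (hassoc : ∀ (Q : Type u) [AddCommGroup Q] [Module k Q] (op : Unit → Q →ₗ[k] Q →ₗ[k] Q),
      SatRel (relSet R₁) op → ∀ x y z, op () (op () x y) z = op () x (op () y z))
    {op₁ : Unit → A →ₗ[k] A →ₗ[k] A} {op₂ : Unit → B →ₗ[k] B →ₗ[k] B} (φ : A →ₗ[k] B)
    (h₁ : IsSymm (fun _ : Unit => e) op₁) (h₂ : IsSymm (fun _ : Unit => e) op₂)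
    (hR₁ : SatRel (relSet R₁) op₁) (hR₂ : SatRel (relSet R₂) op₂) (s : Fin 4 → A × B) :
    comObstruction (mixOp op₁ op₂ φ (.inl ())) (mixOp op₁ op₂ φ (.inr ())) α β
      (s 0) (s 1) (s 2) (s 3) = 0 := by
  have hsat := satRel_freeOp (sumSign e) (R := relSet (combinedRel R₁ R₂ D))
    mem_Homog_of_mem_relSet (Fin 4)
  -- In the free algebra of the law, the class of this tree combination is the obstruction at the
  -- generators, which vanishes there by associativity and the law.
  have hN : comObstruction (graft (.inl ())) (graft (.inr ())) α β (leaf4 k 0) (leaf4 k 1)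
      (leaf4 k 2) (leaf4 k 3) ∈ totalIdeal (sumSign e) (relSet (combinedRel R₁ R₂ D)) (Fin 4) := by
    refine (Submodule.ker_mkQ _).le (LinearMap.mem_ker.mpr ?_)
    rw [map_comObstruction _ (fun x y => (freeOp_mk _ _ (.inl ()) x y).symm)
      (fun x y => (freeOp_mk _ _ (.inr ()) x y).symm)]
    exact comObstruction_eq_zero (hassoc _ _ (satRel_inl hsat)) (law_of_satRel hc hsat) _ _ _ _
  have key := evalAlg_mixOp_eq_zero hD (comObstruction_mem_normalSpan α β) hN φ h₁ h₂ hR₁ hR₂ s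
  have hmap := map_comObstruction (evalAlg (mixOp op₁ op₂ φ) s) (evalAlg_graft _ s (.inl ()))
    (evalAlg_graft _ s (.inr ())) α β (leaf4 k 0) (leaf4 k 1) (leaf4 k 2) (leaf4 k 3)
  rw [key, evalAlg_leaf4, evalAlg_leaf4, evalAlg_leaf4, evalAlg_leaf4] at hmap
  exact hmap.symm

/-- The obstruction for laws between operads with an antisymmetric operation vanishes in the
algebras over the operad of the trivial law. -/
theorem lieObstruction_mixOp {R₁ R₂ : Submodule k (Free3 k fun _ : Unit => (-1 : ℤˣ))}
    {D : F12 k (fun _ : Unit => (-1 : ℤˣ)) (fun _ : Unit => (-1 : ℤˣ)) →ₗ[k]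
      F21 k (fun _ : Unit => (-1 : ℤˣ)) (fun _ : Unit => (-1 : ℤˣ))}
    (hD : IsDistributiveLaw R₁ R₂ D) {α β : k}
    (hc : (D (gen12 k (-1) 1) : Free3 k (sumSign (-1))) =
      α • mixedClass k (-1) (.inr ()) (.inl ()) 1 +
      β • (mixedClass k (-1) (.inr ()) (.inl ()) (finRotate 3) +
        mixedClass k (-1) (.inr ()) (.inl ()) (finRotate 3)⁻¹))
    {op₁ : Unit → A →ₗ[k] A →ₗ[k] A} {op₂ : Unit → B →ₗ[k] B →ₗ[k] B} (φ : A →ₗ[k] B)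
    (h₁ : IsSymm (fun _ : Unit => (-1 : ℤˣ)) op₁) (h₂ : IsSymm (fun _ : Unit => (-1 : ℤˣ)) op₂)
    (hR₁ : SatRel (relSet R₁) op₁) (hR₂ : SatRel (relSet R₂) op₂) (s : Fin 4 → A × B) :
    lieObstruction (mixOp op₁ op₂ φ (.inl ())) (mixOp op₁ op₂ φ (.inr ())) α β
      (s 0) (s 1) (s 2) (s 3) = 0 := by
  have hsat := satRel_freeOp (sumSign (-1)) (R := relSet (combinedRel R₁ R₂ D))
    mem_Homog_of_mem_relSet (Fin 4)
  have hN : lieObstruction (graft (.inl ())) (graft (.inr ())) α β (leaf4 k 0) (leaf4 k 1)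
      (leaf4 k 2) (leaf4 k 3) ∈
      totalIdeal (sumSign (-1)) (relSet (combinedRel R₁ R₂ D)) (Fin 4) := by
    refine (Submodule.ker_mkQ _).le (LinearMap.mem_ker.mpr ?_)
    rw [map_lieObstruction _ (fun x y => (freeOp_mk _ _ (.inl ()) x y).symm)
      (fun x y => (freeOp_mk _ _ (.inr ()) x y).symm)]
    refine lieObstruction_eq_zero (fun x y => ?_) (law_of_satRel hc hsat) _ _ _ _
    simpa using isSymm_freeOp (sumSign (-1)) (relSet (combinedRel R₁ R₂ D)) (Fin 4) (.inl ()) x y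
  have key := evalAlg_mixOp_eq_zero hD (lieObstruction_mem_normalSpan α β) hN φ h₁ h₂ hR₁ hR₂ s
  have hmap := map_lieObstruction (evalAlg (mixOp op₁ op₂ φ) s) (evalAlg_graft _ s (.inl ()))
    (evalAlg_graft _ s (.inr ())) α β (leaf4 k 0) (leaf4 k 1) (leaf4 k 2) (leaf4 k 3)
  rw [key, evalAlg_leaf4, evalAlg_leaf4, evalAlg_leaf4, evalAlg_leaf4] at hmap
  exact hmap.symm

/-- The multiplication of `k` and its graph detect the coefficients of a law over `Com`. -/
theorem coeff_eq_zero_of_comObstruction [CharZero k] {α β : k}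
    (h : ∀ s : Fin 4 → k × k, comObstruction
      (mixOp (fun _ : Unit => LinearMap.mul k k) (fun _ : Unit => LinearMap.mul k k) .id (.inl ()))
      (mixOp (fun _ : Unit => LinearMap.mul k k) (fun _ : Unit => LinearMap.mul k k) .id (.inr ()))
      α β (s 0) (s 1) (s 2) (s 3) = 0) : α = 0 ∧ β = 0 := by
  -- Since `dot` reads first and `star` second components, the value (0, 1) keeps only the trees in
  -- which the leaf is a direct argument of `star`, and (1, 0) those in which it lies under a `dot`.
  -- The trees a*(…) that remain here give α² + 2αβ = 0.
  have h1 := congrArg Prod.snd (h ![(0, 1), (1, 0), (1, 0), (1, 0)])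
  -- Only b*((c·d)·a) remains, whence αβ = 0.
  have h2 := congrArg Prod.snd (h ![(1, 0), (0, 1), (1, 0), (1, 0)])
  -- Only products of two dots remain: α - αβ - 2β² = 0. Once α = 0 this forces β = 0 in
  -- characteristic 0.
  have h3 := congrArg Prod.snd (h ![(1, 0), (1, 0), (1, 0), (1, 0)])
  simp [comObstruction, lawRhs] at h1 h2 h3
  have hα : α = 0 := by
    rcases h2 with h2 | h2
    · exact h2
    · subst h2
      simpa using h1
  subst hα
  exact ⟨rfl, by simpa using h3⟩

/-- The cross product detects the coefficients of a law over `Lie`. -/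
theorem coeff_eq_zero_of_lieObstruction {α β : k}
    (h : ∀ s : Fin 4 → (Fin 3 → k) × (Fin 3 → k), lieObstruction
      (mixOp (fun _ : Unit => crossProduct) (fun _ : Unit => crossProduct) .id (.inl ()))
      (mixOp (fun _ : Unit => crossProduct) (fun _ : Unit => crossProduct) .id (.inr ()))
      α β (s 0) (s 1) (s 2) (s 3) = 0) : α = 0 ∧ β = 0 := by
  -- With a, c under a `dot` and b, d directly under a `star`, only -β²({d,{b,[c,a]}} +
  -- {b,{d,[a,c]}}) survives. At a = b = e₁, c = e₂, d = e₃ the second bracket vanishes and the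
  -- value is β² e₁.
  have h1 := congrArg Prod.snd (h ![(![1, 0, 0], 0), (0, ![1, 0, 0]), (![0, 1, 0], 0),
    (0, ![0, 0, 1])])
  -- With a, b under a `dot` and c, d directly under a `star`, only α {{c,d},[a,b]} survives once β
  -- = 0; its value here is -α e₁.
  have h2 := congrArg Prod.snd (h ![(![1, 0, 0], 0), (![0, 1, 0], 0), (0, ![1, 0, 0]),
    (0, ![0, 0, 1])])
  simp [lieObstruction, lawRhs, cross_apply] at h1 h2
  subst h1
  exact ⟨by simpa using h2, rfl⟩

theorem eq_zero_of_coeff_eq_zero {e : ℤˣ}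
    {R₁ R₂ : Submodule k (Free3 k fun _ : Unit => e)}
    {D : F12 k (fun _ : Unit => e) (fun _ : Unit => e) →ₗ[k]
      F21 k (fun _ : Unit => e) (fun _ : Unit => e)}
    (hD : IsDistributiveLaw R₁ R₂ D) {α β : k}
    (hc : (D (gen12 k e 1) : Free3 k (sumSign e)) =
      α • mixedClass k e (.inr ()) (.inl ()) 1 +
      β • (mixedClass k e (.inr ()) (.inl ()) (finRotate 3) +
        mixedClass k e (.inr ()) (.inl ()) (finRotate 3)⁻¹)) (h : α = 0 ∧ β = 0) : D = 0 := by
  refine eq_zero_of_gen12 hD.1 ?_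
  rw [hc, h.1, h.2, zero_smul, zero_smul, add_zero]

/-- The only distributive law of `Com` over `Com` is the trivial one. -/
theorem eq_zero_of_isDistributiveLaw_com [CharZero k]
    {D : F12 k comSign comSign →ₗ[k] F21 k comSign comSign}
    (hD : IsDistributiveLaw (comRel k) (comRel k) D) : D = 0 := by
  obtain ⟨α, β, hc⟩ := exists_coeff (e := 1) hD.1
  have hs : IsSymm comSign fun _ : Unit => LinearMap.mul k k := by
    intro c x y
    simp [mul_comm]
  have hR : SatRel (relSet (comRel k)) fun _ : Unit => LinearMap.mul k k :=
    satRel_comRel hs fun x y z => by simp [mul_assoc]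
  exact eq_zero_of_coeff_eq_zero hD hc (coeff_eq_zero_of_comObstruction
    (comObstruction_mixOp hD hc (fun _ _ _ _ h => assoc_of_satRel h) .id hs hs hR hR))

/-- The only distributive law of `Lie` over `Lie` is the trivial one. -/
theorem eq_zero_of_isDistributiveLaw_lie [CharZero k]
    {D : F12 k lieSign lieSign →ₗ[k] F21 k lieSign lieSign}
    (hD : IsDistributiveLaw (lieRel k) (lieRel k) D) : D = 0 := by
  obtain ⟨α, β, hc⟩ := exists_coeff (e := -1) hD.1
  have hs : IsSymm lieSign fun _ : Unit => (crossProduct : (Fin 3 → k) →ₗ[k] _) := by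
    intro c x y
    simp
  have hR : SatRel (relSet (lieRel k)) fun _ : Unit => (crossProduct : (Fin 3 → k) →ₗ[k] _) :=
    satRel_lieRel hs fun x y z => by
      have := jacobi_cross x y z
      -- `jacobi_cross` has the inner product on the right, the relation of Lie has it on the left.
      have e : ∀ u v w : Fin 3 → k, crossProduct (crossProduct u v) w =
          -crossProduct w (crossProduct u v) := fun _ _ _ => (cross_anticomm _ _).symm
      simp only [e]
      rw [← neg_eq_zero, ← this]
      abel
  exact eq_zero_of_coeff_eq_zero hD hc (coeff_eq_zero_of_lieObstruction
    (lieObstruction_mixOp hD hc .id hs hs hR hR))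

end ComAndLie

end DistLaw

theorem mainTheorem6 (k : Type*) [Field k] [CharZero k] :
    (∀ D : DistLaw.F12 k DistLaw.comSign DistLaw.comSign →ₗ[k]
        DistLaw.F21 k DistLaw.comSign DistLaw.comSign,
      DistLaw.IsDistributiveLaw (DistLaw.comRel k) (DistLaw.comRel k) D ↔ D = 0) ∧
    (∀ D : DistLaw.F12 k DistLaw.lieSign DistLaw.lieSign →ₗ[k]
        DistLaw.F21 k DistLaw.lieSign DistLaw.lieSign,
      DistLaw.IsDistributiveLaw (DistLaw.lieRel k) (DistLaw.lieRel k) D ↔ D = 0) := by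
  refine ⟨fun D => ⟨DistLaw.eq_zero_of_isDistributiveLaw_com, ?_⟩,
    fun D => ⟨DistLaw.eq_zero_of_isDistributiveLaw_lie, ?_⟩⟩
  · rintro rfl
    exact DistLaw.isDistributiveLaw_zero _ _
  · rintro rfl
    exact DistLaw.isDistributiveLaw_zero _ _
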